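/- Let $\mathcal L\subset\mathbb R^n$ be a Bravais lattice with basis $e_1,\dots,e_n$, and let $Y=\{\sum_i x_ie_i:0<x_i<1\}$ be its open unit cell. Write $F\cdot G=\operatorname{Tr}(F^TG)$ for $F,G\in\mathbb R^{n\times n}$, and let $\mathbb L$ be the set of all symmetric linear maps (tensors) $L:\mathbb R^{n\times n}\to\mathbb R^{n\times n}$ that are either positive definite or elasticity tensors (i.e. have also the minor symmetries and are positive definite on symmetric matrices). For symmetric tensors, $A\ge B$ means that $A-B$ is positive semi-definite. Let $0<\theta<1$ and, for measurable $\Omega\subset Y$, let $$L(x,\Omega)=L_1\in\mathbb L\ \text{ for }x\in\Omega,\qquad L(x,\Omega)=L_0\in\mathbb L\ \text{ for }x\in Y\setminus\Omega,\qquad (L_0)_{piqj}=\mu_1\delta_{ij}\delta_{pq}+\mu_2\delta_{pj}\delta_{iq}+\lambda\delta_{ip}\delta_{jq}.$$ Put $\Delta L=L_0-L_1$, $\kappa=\mu_1+\mu_2+\lambda$, and assume that the range of $\Delta L$ contains all symmetric matrices; $\Delta L^{-1}I$ denotes the unique element of the range of $\Delta L$ that $\Delta L$ maps to the identity matrix $I$.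 The effective tensor $L^e(\Omega)$ is the symmetric tensor such that, for all $F\in\mathbb R^{n\times n}$, $$F\cdot L^e(\Omega)F=\inf\Big\{\frac1{|Y|}\int_Y(\nabla v+F)\cdot L(x,\Omega)(\nabla v+F)\,dx:\ v\in W^{1,2}_{per}(Y;\mathbb R^n)\Big\}.$$ For a symmetric matrix $Q$, an open set $\Omega\subset Y$ with $|\Omega|/|Y|=\theta$ is called a periodic E-inclusion corresponding to $Q$ and volume fraction $\theta$ if there is $u\in W^{2,2}_{per}(Y)$ with $\Delta u=\operatorname{Tr}Q$ a.e. on $\Omega$, $\Delta u=p_0$ a.e. on $Y\setminus\Omega$ and $\nabla\nabla u=Q$ a.e. on $\Omega$, where $(1-\theta)p_0+\theta\operatorname{Tr}Q=0$. Then, for every measurable $\Omega\subset Y$ with $|\Omega|/|Y|=\theta$, the tensor $L^e(\Omega)$ exists and is unique, and the following hold. 1. If $L_1\ge L_0$, then $(1-\theta)-\kappa\operatorname{Tr}(\Delta L^{-1}I)\ne0$ and, for every measurable $\Omega\subset Y$ with $|\Omega|/|Y|=\theta$ and every symmetric $F$, $$F\cdot L^e(\Omega)F-F\cdot L_0F\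 \ge\ \frac{\theta\,\kappa}{(1-\theta)-\kappa\operatorname{Tr}(\Delta L^{-1}I)}(\operatorname{Tr}F)^2 .$$ If $L_1\le L_0$, the same holds with $\ge$ replaced by $\le$. 2. In either case, for every symmetric $F$ with $\operatorname{Tr}F\ne0$ and every open $\Omega\subset Y$ with $|\Omega|/|Y|=\theta$, equality holds in the bound if and only if $\Omega$ is a periodic E-inclusion corresponding to $$Q=\frac{F}{\operatorname{Tr}F}\Big[1-\frac{\kappa}{1-\theta}\operatorname{Tr}(\Delta L^{-1}I)\Big]+\frac{\kappa}{1-\theta}\,\Delta L^{-1}I$$ and volume fraction $\theta$ (in particular $Q$ is then symmetric). -/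

import Mathlib

open MeasureTheory Matrix
open scoped ContDiff

namespace TwoPhase

/-! ### Tensors -/

/-- The inner product `F · G = Tr (Fᵀ G)` of two matrices. -/
def frob {n : ℕ} (F G : Matrix (Fin n) (Fin n) ℝ) : ℝ := ∑ p, ∑ i, F p i * G p i

/-- Fourth order tensors, as linear maps of `n × n` matrices,
`(L F)_{pi} = ∑_{q,j} L_{piqj} F_{qj}`. -/
abbrev Tensor (n : ℕ) := Matrix (Fin n) (Fin n) ℝ →ₗ[ℝ] Matrix (Fin n) (Fin n) ℝ

/-- Major symmetry `L_{piqj} = L_{qjpi}`. -/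
def Tensor.IsSymmetric {n : ℕ} (L : Tensor n) : Prop :=
  ∀ F G, frob F (L G) = frob (L F) G

/-- `L` is positive definite on all `n × n` matrices. -/
def Tensor.IsPosDef {n : ℕ} (L : Tensor n) : Prop :=
  ∀ F, F ≠ 0 → 0 < frob F (L F)

/-- `L` is an elasticity tensor (apart from the major symmetry): it has the minor symmetries
(its values are symmetric, and it depends only on the symmetric part of its argument), and it is
positive definite on symmetric matrices. -/
def Tensor.IsElasticity {n : ℕ} (L : Tensor n) : Prop :=
  (∀ F, (L F).IsSymm) ∧ (∀ F, L Fᵀ = L F) ∧ ∀ F, F.IsSymm → F ≠ 0 → 0 < frob F (L F)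

/-- The class of symmetric tensors that are positive definite or elasticity tensors. -/
def Tensor.Admissible {n : ℕ} (L : Tensor n) : Prop :=
  L.IsSymmetric ∧ (L.IsPosDef ∨ L.IsElasticity)

/-- The ordering of symmetric tensors: `A ≤ B` if `B - A` is positive semi-definite. -/
def Tensor.Le {n : ℕ} (A B : Tensor n) : Prop := ∀ F, 0 ≤ frob F ((B - A) F)

/-- The tensor `L_{piqj} = μ₁ δ_{ij} δ_{pq} + μ₂ δ_{pj} δ_{iq} + lam δ_{ip} δ_{jq}`. -/
def isoTensor (n : ℕ) (μ₁ μ₂ lam : ℝ) : Tensor n where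
  toFun F := μ₁ • F + μ₂ • Fᵀ + (lam * F.trace) • (1 : Matrix (Fin n) (Fin n) ℝ)
  map_add' F G := by
    simp only [transpose_add, trace_add, smul_add, mul_add, add_smul]; abel
  map_smul' c F := by
    simp only [transpose_smul, trace_smul, smul_add, smul_smul, RingHom.id_apply, smul_eq_mul]
    rw [mul_comm c μ₁, mul_comm c μ₂, mul_left_comm c lam]

theorem isoTensor_components (n : ℕ) (μ₁ μ₂ lam : ℝ) (p i q j : Fin n) :
    isoTensor n μ₁ μ₂ lam (Matrix.single q j 1) p i =
      μ₁ * ((if i = j then 1 else 0) * (if p = q then 1 else 0)) +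
        μ₂ * ((if p = j then 1 else 0) * (if i = q then 1 else 0)) +
        lam * ((if i = p then 1 else 0) * (if j = q then 1 else 0)) := by
  simp only [isoTensor, LinearMap.coe_mk, AddHom.coe_mk, Matrix.add_apply, Matrix.smul_apply,
    Matrix.transpose_apply, Matrix.single_apply, Matrix.one_apply, smul_eq_mul, Matrix.trace,
    Matrix.diag]
  have h : ∑ x, (if q = x ∧ j = x then (1 : ℝ) else 0) = if j = q then 1 else 0 := by
    rw [Finset.sum_eq_single q]
    · simp
    · intro x _ hx
      exact if_neg fun h => hx h.1.symm
    · simp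
  rw [h]
  by_cases h1 : i = j <;> by_cases h2 : p = q <;> by_cases h3 : p = j <;> by_cases h4 : i = q <;>
    by_cases h5 : i = p <;> simp_all [eq_comm]

/-- A symmetric tensor maps its range bijectively onto its range. -/
theorem existsUnique_mem_range {n : ℕ} {T : Tensor n} (hT : T.IsSymmetric)
    {X : Matrix (Fin n) (Fin n) ℝ} (hX : X ∈ LinearMap.range T) :
    ∃! M, M ∈ LinearMap.range T ∧ T M = X := by
  have frob0 : ∀ F : Matrix (Fin n) (Fin n) ℝ, frob F F = 0 → F = 0 := by
    intro F hF
    have h1 : ∀ p, 0 ≤ ∑ i, F p i * F p i :=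
      fun p => Finset.sum_nonneg fun i _ => mul_self_nonneg _
    have h2 : ∀ p, ∑ i, F p i * F p i = 0 := fun p =>
      (Finset.sum_eq_zero_iff_of_nonneg fun p _ => h1 p).1 hF p (Finset.mem_univ p)
    ext p i
    exact mul_self_eq_zero.1
      ((Finset.sum_eq_zero_iff_of_nonneg fun i _ => mul_self_nonneg (F p i)).1 (h2 p) i
        (Finset.mem_univ i))
  have hinj : ∀ M, M ∈ LinearMap.range T → T M = 0 → M = 0 := by
    rintro _ ⟨G, rfl⟩ hG
    apply frob0
    rw [hT (T G) G, hG]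
    simp [frob]
  let R : LinearMap.range T →ₗ[ℝ] LinearMap.range T :=
    T.restrict fun x _ => LinearMap.mem_range_self T x
  have hRinj : Function.Injective R := by
    rw [injective_iff_map_eq_zero]
    rintro ⟨x, hx⟩ h
    have h' : T x = 0 := congrArg Subtype.val h
    exact Subtype.ext (hinj x hx h')
  obtain ⟨⟨M, hM⟩, hMX⟩ := LinearMap.surjective_of_injective hRinj ⟨X, hX⟩
  have hMX' : T M = X := congrArg Subtype.val hMX
  refine ⟨M, ⟨hM, hMX'⟩, ?_⟩
  rintro M' ⟨hM', hM'X⟩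
  have : M' - M = 0 := hinj _ (Submodule.sub_mem _ hM' hM) (by rw [map_sub, hM'X, hMX', sub_self])
  exact sub_eq_zero.1 this

open Classical in
/-- `T⁻¹ X` for a symmetric tensor `T` and `X` in its range: the unique element of the range of `T`
that `T` maps to `X`. (This is the usual inverse if `T` is invertible, and the symmetric preimage
of `X` if the range of `T` is the space of symmetric matrices.) -/
noncomputable def Tensor.inv {n : ℕ} (T : Tensor n) (X : Matrix (Fin n) (Fin n) ℝ) :
    Matrix (Fin n) (Fin n) ℝ :=
  if h : ∃ M, M ∈ LinearMap.range T ∧ T M = X then h.choose else 0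

theorem Tensor.inv_spec {n : ℕ} {T : Tensor n} (hT : T.IsSymmetric)
    {X : Matrix (Fin n) (Fin n) ℝ} (hX : X ∈ LinearMap.range T) :
    T.inv X ∈ LinearMap.range T ∧ T (T.inv X) = X := by
  have h : ∃ M, M ∈ LinearMap.range T ∧ T M = X := (existsUnique_mem_range hT hX).exists
  unfold Tensor.inv
  rw [dif_pos h]
  exact h.choose_spec

/-! ### Periodic Sobolev functions -/

/-- The open unit cell `{∑ xᵢ bᵢ : 0 < xᵢ < 1}` of the lattice spanned by the basis `b`. -/
def unitCell {n : ℕ} (b : Module.Basis (Fin n) ℝ (EuclideanSpace ℝ (Fin n))) :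
    Set (EuclideanSpace ℝ (Fin n)) :=
  {x | ∀ i, 0 < b.repr x i ∧ b.repr x i < 1}

/-- `f` is periodic with respect to the lattice spanned by the basis `b`. -/
def IsPeriodic {n : ℕ} (b : Module.Basis (Fin n) ℝ (EuclideanSpace ℝ (Fin n)))
    (f : EuclideanSpace ℝ (Fin n) → ℝ) : Prop :=
  ∀ i x, f (x + b i) = f x

/-- `f` is locally square integrable. -/
def LocL2 {n : ℕ} (f : EuclideanSpace ℝ (Fin n) → ℝ) : Prop :=
  ∀ K : Set (EuclideanSpace ℝ (Fin n)), IsCompact K → MemLp f 2 (volume.restrict K)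

/-- `g` is the weak partial derivative `∂ᵢ f` on `ℝⁿ`. -/
def IsWeakPartial {n : ℕ} (i : Fin n) (f g : EuclideanSpace ℝ (Fin n) → ℝ) : Prop :=
  ∀ φ : EuclideanSpace ℝ (Fin n) → ℝ, ContDiff ℝ ∞ φ → HasCompactSupport φ →
    ∫ x, f x * fderiv ℝ φ x (EuclideanSpace.single i 1) = -∫ x, g x * φ x

/-- `v ∈ W^{1,2}_per(Y; ℝⁿ)` (periodic and in `W^{1,2}_loc(ℝⁿ; ℝⁿ)`), with weak gradient `G`,
`G_{pi} = ∂ᵢ v_p`. -/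
structure IsW12Per {n : ℕ} (b : Module.Basis (Fin n) ℝ (EuclideanSpace ℝ (Fin n)))
    (v : Fin n → EuclideanSpace ℝ (Fin n) → ℝ)
    (G : EuclideanSpace ℝ (Fin n) → Matrix (Fin n) (Fin n) ℝ) : Prop where
  periodic : ∀ p, IsPeriodic b (v p)
  locL2 : ∀ p, LocL2 (v p)
  grad_locL2 : ∀ p i, LocL2 (fun x => G x p i)
  grad : ∀ p i, IsWeakPartial i (v p) (fun x => G x p i)

/-- `u ∈ W^{2,2}_per(Y)` (periodic and in `W^{2,2}_loc(ℝⁿ)`), with weak gradient `g` and weak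
second gradient `H`. -/
structure IsW22Per {n : ℕ} (b : Module.Basis (Fin n) ℝ (EuclideanSpace ℝ (Fin n)))
    (u : EuclideanSpace ℝ (Fin n) → ℝ) (g : Fin n → EuclideanSpace ℝ (Fin n) → ℝ)
    (H : EuclideanSpace ℝ (Fin n) → Matrix (Fin n) (Fin n) ℝ) : Prop where
  periodic : IsPeriodic b u
  locL2 : LocL2 u
  grad_locL2 : ∀ i, LocL2 (g i)
  grad : ∀ i, IsWeakPartial i u (g i)
  hess_locL2 : ∀ i j, LocL2 (fun x => H x i j)
  hess : ∀ i j, IsWeakPartial j (g i) (fun x => H x i j)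

/-! ### Effective tensor -/

open Classical in
/-- The local tensor `L(x, Ω)`: `L₁` on `Ω`, and `L₀` off `Ω`. -/
noncomputable def twoPhase {n : ℕ} (L₁ L₀ : Tensor n) (Ω : Set (EuclideanSpace ℝ (Fin n)))
    (x : EuclideanSpace ℝ (Fin n)) : Tensor n :=
  if x ∈ Ω then L₁ else L₀

/-- The energies `½ ⨍_Y (∇v + F) · L(x, Ω) (∇v + F) dx`, for `v ∈ W^{1,2}_per(Y; ℝⁿ)`. -/
def energies {n : ℕ} (b : Module.Basis (Fin n) ℝ (EuclideanSpace ℝ (Fin n)))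
    (L₁ L₀ : Tensor n) (Ω : Set (EuclideanSpace ℝ (Fin n))) (F : Matrix (Fin n) (Fin n) ℝ) :
    Set ℝ :=
  {e | ∃ v G, IsW12Per b v G ∧
    e = 1 / 2 * ⨍ x in unitCell b, frob (G x + F) (twoPhase L₁ L₀ Ω x (G x + F))}

/-- `Le` is the effective tensor `L^e(Ω)`: the symmetric tensor for which `½ F · Le F` is, for
every matrix `F`, the least energy (infimum) under the average applied field `F`. -/
def IsEffectiveTensor {n : ℕ} (b : Module.Basis (Fin n) ℝ (EuclideanSpace ℝ (Fin n)))
    (L₁ L₀ : Tensor n) (Ω : Set (EuclideanSpace ℝ (Fin n))) (Le : Tensor n) : Prop :=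
  Le.IsSymmetric ∧ ∀ F, IsGLB (energies b L₁ L₀ Ω F) (1 / 2 * frob F (Le F))

/-! ### Periodic E-inclusions -/

/-- The volume fraction `|S| / |Y|`. -/
noncomputable def volFrac {n : ℕ} (b : Module.Basis (Fin n) ℝ (EuclideanSpace ℝ (Fin n)))
    (S : Set (EuclideanSpace ℝ (Fin n))) : ℝ :=
  volume.real S / volume.real (unitCell b)

open Classical in
/-- `Ω ⊆ Y` (more precisely its periodic extension) is a periodic E-inclusion corresponding to the
symmetric matrix `Q`: some `u ∈ W^{2,2}_per(Y)` solves `Δu = Tr Q` on `Ω`, `Δu = p₀` on `Y \ Ω`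
and `∇∇u = Q` a.e. on `Ω`, where `p₀ |Y \ Ω| + Tr Q |Ω| = 0`. -/
def IsPeriodicEInclusion {n : ℕ} (b : Module.Basis (Fin n) ℝ (EuclideanSpace ℝ (Fin n)))
    (Ω : Set (EuclideanSpace ℝ (Fin n))) (Q : Matrix (Fin n) (Fin n) ℝ) : Prop :=
  IsOpen Ω ∧ Ω ⊆ unitCell b ∧ Q.IsSymm ∧
    ∃ (u : EuclideanSpace ℝ (Fin n) → ℝ) (g : Fin n → EuclideanSpace ℝ (Fin n) → ℝ)
      (H : EuclideanSpace ℝ (Fin n) → Matrix (Fin n) (Fin n) ℝ) (p₀ : ℝ),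
      IsW22Per b u g H ∧
      p₀ * volFrac b (unitCell b \ Ω) + Q.trace * volFrac b Ω = 0 ∧
      (∀ᵐ x ∂volume.restrict (unitCell b), (H x).trace = if x ∈ Ω then Q.trace else p₀) ∧
      ∀ᵐ x ∂volume.restrict Ω, H x = Q

/-! ### The bound -/

/-- The coefficient `(1 - θ) - κ Tr (ΔL⁻¹ I)`, `ΔL = L₀ - L₁`. -/
noncomputable def boundDenom {n : ℕ} (L₁ L₀ : Tensor n) (κ θ : ℝ) : ℝ :=
  (1 - θ) - κ * ((L₀ - L₁).inv 1).trace

/-- The bound `θ κ (Tr F)² / ((1 - θ) - κ Tr (ΔL⁻¹ I))`. -/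
noncomputable def bound {n : ℕ} (L₁ L₀ : Tensor n) (κ θ : ℝ) (F : Matrix (Fin n) (Fin n) ℝ) : ℝ :=
  θ * κ / boundDenom L₁ L₀ κ θ * F.trace ^ 2

/-- The matrix
`Q = (F / Tr F) (1 - κ / (1 - θ) Tr (ΔL⁻¹ I)) + κ / (1 - θ) ΔL⁻¹ I`. -/
noncomputable def optimalQ {n : ℕ} (L₁ L₀ : Tensor n) (κ θ : ℝ) (F : Matrix (Fin n) (Fin n) ℝ) :
    Matrix (Fin n) (Fin n) ℝ :=
  ((1 - κ / (1 - θ) * ((L₀ - L₁).inv 1).trace) / F.trace) • F +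
    (κ / (1 - θ)) • (L₀ - L₁).inv 1

end TwoPhase

/-! The proof is a polarization argument of Hashin–Shtrikman type, reduced to one exact identity.
Put D = L₁ − L₀ and X = −ΔL⁻¹I, so that D X = I, and let χ be the characteristic function of Ω. For
real t set G₀ = −(t/κ)∇∇u, where u is periodic and Δu = χ − θ (`exists_poisson`, by Fourier
multipliers). Periodic gradients satisfy ⨍ G·G'ᵀ = ⨍ Tr G Tr G', because the Fourier symbol ξᵢξⱼ is
symmetric (`IsW12Per.integral_mul_comm`). As G₀ is symmetric, the isotropic L₀ then acts on the pair
(G, G₀) through κ and the traces alone, and ⨍ G·L₀G₀ = −t ⨍ χ Tr G for every periodic gradient G.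

Completing the square with this relation gives `cellEnergy_eq`: the energy of G equals c(t) + ⨍
(G−G₀)·L₀(G−G₀) + ⨍ χ (G+F−tX)·D(G+F−tX), where c(t) is a quadratic polynomial in t (`polarBound`).
Its critical point t = κ Tr F / d, with d the denominator of the bound, produces the stated
constant. If D ≥ 0, the last two terms are nonnegative and c(t) is a lower bound. If D ≤ 0, the
trial field G = G₀ makes c(t) an upper bound. The sign of d is settled in `boundDenom_pos_of_le` and
`boundDenom_neg_of_le`.

Equality holds exactly when the last term, the defect, vanishes at G₀. In the lower bound this comes
from applying coercivity of L₀ on periodic gradients (`exists_coercive`) to near-minimizers. In the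
upper bound it comes from the nonnegativity of the two-phase energy. A vanishing defect means
D(G₀+F−tX) = 0 a.e. on Ω. Since the range of ΔL contains the symmetric matrices and a symmetric
tensor is injective on its range, this forces G₀ = tX − F on Ω. The constant tX − F is −(t/κ)(1−θ)Q
(`smul_optimalQ`), so u/(1−θ) is the potential of a periodic E-inclusion for Q, and conversely.

The effective tensor exists because the infimum of a positive semidefinite form over translates of a
subspace is again a quadratic form (`exists_isGLB_bilin`). Uniqueness is polarization. -/

namespace TwoPhase

/-! ### The unit cell and the torus -/

section Torus

attribute [local instance] instMeasureSpaceUnitAddCircle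

open UnitAddTorus

variable {n : ℕ} (b : Module.Basis (Fin n) ℝ (EuclideanSpace ℝ (Fin n)))

/-- The normalized Lebesgue measure on the unit cell. -/
noncomputable def cellMeasure : Measure (EuclideanSpace ℝ (Fin n)) :=
  (volume (unitCell b))⁻¹ • volume.restrict (unitCell b)

/-- The projection to the torus. -/
noncomputable def toTorus (x : EuclideanSpace ℝ (Fin n)) : UnitAddTorus (Fin n) :=
  fun i => (b.repr x i : UnitAddCircle)

/-- The point of the half-open cell over a point of the torus. -/
noncomputable def ofTorus (t : UnitAddTorus (Fin n)) : EuclideanSpace ℝ (Fin n) :=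
  ∑ i, ((AddCircle.equivIoc (1 : ℝ) 0 (t i) : Set.Ioc (0 : ℝ) (0 + 1)) : ℝ) • b i

/-- Lattice points. -/
noncomputable def latticePoint (m : Fin n → ℤ) : EuclideanSpace ℝ (Fin n) := ∑ i, (m i : ℝ) • b i

theorem repr_sum_smul (c : Fin n → ℝ) (i : Fin n) : b.repr (∑ j, c j • b j) i = c i := by
  rw [Module.Basis.repr_sum_self]

theorem repr_latticePoint (m : Fin n → ℤ) (i : Fin n) : b.repr (latticePoint b m) i = m i :=
  repr_sum_smul b _ i

theorem continuous_repr (i : Fin n) : Continuous fun x => b.repr x i :=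
  (b.coord i).continuous_of_finiteDimensional

theorem continuous_toTorus : Continuous (toTorus b) :=
  continuous_pi fun i => (AddCircle.continuous_mk' 1).comp (continuous_repr b i)

theorem measurable_ofTorus : Measurable (ofTorus b) := by
  unfold ofTorus
  refine Finset.measurable_sum _ fun i _ => Measurable.smul_const ?_ _
  exact (measurable_subtype_coe.comp (AddCircle.measurableEquivIoc (1 : ℝ) 0).measurable).comp
    (measurable_pi_apply i)

theorem toTorus_ofTorus (t : UnitAddTorus (Fin n)) : toTorus b (ofTorus b t) = t := by
  funext i
  rw [toTorus, ofTorus, repr_sum_smul]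
  exact (AddCircle.equivIoc (1 : ℝ) 0).symm_apply_apply (t i)

theorem toTorus_add_latticePoint (x : EuclideanSpace ℝ (Fin n)) (m : Fin n → ℤ) :
    toTorus b (x + latticePoint b m) = toTorus b x := by
  funext i
  rw [toTorus, toTorus, map_add, Finsupp.add_apply, repr_latticePoint]
  rw [AddCircle.coe_add]
  have : ((m i : ℝ) : UnitAddCircle) = 0 := by
    rw [AddCircle.coe_eq_zero_iff]
    exact ⟨m i, by simp⟩
  rw [this, add_zero]

theorem ofTorus_toTorus {x : EuclideanSpace ℝ (Fin n)} (hx : x ∈ unitCell b) :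
    ofTorus b (toTorus b x) = x := by
  rw [ofTorus]
  conv_rhs => rw [← b.sum_repr x]
  refine Finset.sum_congr rfl fun i _ => ?_
  congr 1
  have h := hx i
  have := AddCircle.equivIoc_coe_of_mem (p := (1 : ℝ)) (a := 0) (y := b.repr x i)
    ⟨h.1, by linarith [h.2]⟩
  rw [toTorus, this]

theorem isOpen_unitCell : IsOpen (unitCell b) := by
  have : unitCell b = ⋂ i, {x | 0 < b.repr x i ∧ b.repr x i < 1} := by
    ext x; simp [unitCell]
  rw [this]
  refine isOpen_iInter_of_finite fun i => ?_
  exact (isOpen_lt continuous_const (continuous_repr b i)).inter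
    (isOpen_lt (continuous_repr b i) continuous_const)

theorem measurableSet_unitCell : MeasurableSet (unitCell b) := (isOpen_unitCell b).measurableSet

/-- The quotient map preserves measure on each half-open interval, and the open and half-open cubes
differ by a null set. -/
theorem measurePreserving_cube :
    MeasurePreserving (fun (x : Fin n → ℝ) i => (x i : UnitAddCircle))
      (volume.restrict (Set.univ.pi fun _ => Set.Ioo (0 : ℝ) 1))
      (volume : Measure (UnitAddTorus (Fin n))) := by
  have h := measurePreserving_pi (ι := Fin n) _ _ (fun _ => AddCircle.measurePreserving_mk (1 : ℝ) 0)
  have e1 : (Measure.pi fun _ : Fin n => (volume : Measure ℝ).restrict (Set.Ioc (0 : ℝ) (0 + 1)))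
      = volume.restrict (Set.univ.pi fun _ => Set.Ioo (0 : ℝ) 1) := by
    rw [← Measure.restrict_pi_pi]
    refine Measure.restrict_congr_set ?_
    rw [zero_add]
    exact (Measure.univ_pi_Ioc_ae_eq_Icc (μ := fun _ => volume)).trans
      (Measure.univ_pi_Ioo_ae_eq_Icc (μ := fun _ => volume)).symm
  rw [e1] at h
  -- The circle carries two measures, arc length and normalized Haar measure; at period one they
  -- coincide.
  have h3 : (AddCircle.measureSpace (1 : ℝ)).volume = AddCircle.haarAddCircle := by
    rw [AddCircle.volume_eq_smul_haarAddCircle]; simp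
  rw [h3] at h
  exact h

/-- The coordinate map sends Lebesgue measure to a Haar measure, hence to a multiple c of Lebesgue
measure. The cell is the preimage of the unit cube, so c is its volume and the normalization cancels
it. -/
theorem map_cellMeasure : Measure.map b.equivFunL (cellMeasure b) =
    volume.restrict (Set.univ.pi fun _ => Set.Ioo (0 : ℝ) 1) := by
  have hpre : unitCell b = b.equivFunL ⁻¹' (Set.univ.pi fun _ => Set.Ioo (0 : ℝ) 1) := by
    ext x; simp [unitCell, Set.mem_pi]
  have hme : MeasurableSet (Set.univ.pi fun _ : Fin n => Set.Ioo (0 : ℝ) 1) :=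
    MeasurableSet.univ_pi fun _ => measurableSet_Ioo
  have hm : Measurable (b.equivFunL : EuclideanSpace ℝ (Fin n) → Fin n → ℝ) :=
    b.equivFunL.continuous.measurable
  have : (Measure.map b.equivFunL (volume : Measure (EuclideanSpace ℝ (Fin n)))).IsAddHaarMeasure :=
    b.equivFunL.isAddHaarMeasure_map volume
  have hc := Measure.isAddLeftInvariant_eq_smul
    (Measure.map b.equivFunL (volume : Measure (EuclideanSpace ℝ (Fin n)))) volume
  set c := (Measure.map b.equivFunL (volume : Measure (EuclideanSpace ℝ (Fin n)))).addHaarScalarFactor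
    volume with hcdef
  have hc0 : c ≠ 0 := by
    intro h
    rw [h, zero_smul] at hc
    have := isOpen_univ.measure_pos (Measure.map b.equivFunL
      (volume : Measure (EuclideanSpace ℝ (Fin n)))) Set.univ_nonempty
    rw [hc] at this
    simp at this
  have hvol : volume (unitCell b) = c := by
    rw [hpre, ← Measure.map_apply hm hme, hc]
    simp [volume_pi, Measure.pi_pi]
  rw [cellMeasure, Measure.map_smul, hvol, hpre, ← Measure.restrict_map hm hme, hc,
    Measure.restrict_smul]
  rw [show (c : NNReal) • (volume.restrict (Set.univ.pi fun _ : Fin n => Set.Ioo (0 : ℝ) 1)) =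
    (c : ENNReal) • (volume.restrict (Set.univ.pi fun _ : Fin n => Set.Ioo (0 : ℝ) 1)) from rfl,
    smul_smul, ENNReal.inv_mul_cancel (by simpa using hc0) (by simp), one_smul]

theorem measurePreserving_toTorus :
    MeasurePreserving (toTorus b) (cellMeasure b) (volume : Measure (UnitAddTorus (Fin n))) := by
  have h1 : MeasurePreserving b.equivFunL (cellMeasure b)
      (volume.restrict (Set.univ.pi fun _ => Set.Ioo (0 : ℝ) 1)) :=
    ⟨b.equivFunL.continuous.measurable, map_cellMeasure b⟩
  exact measurePreserving_cube.comp h1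

theorem volume_unitCell_ne_top : volume (unitCell b) ≠ ⊤ := by
  refine (measure_mono (fun x hx => ?_)).trans_lt
    (ZSpan.fundamentalDomain_isBounded b).measure_lt_top |>.ne
  rw [ZSpan.mem_fundamentalDomain]
  exact fun i => ⟨(hx i).1.le, (hx i).2⟩

theorem volume_unitCell_ne_zero : volume (unitCell b) ≠ 0 := by
  refine ((isOpen_unitCell b).measure_pos volume ⟨∑ i, (1 / 2 : ℝ) • b i, fun i => ?_⟩).ne'
  rw [repr_sum_smul b (fun _ => (1/2 : ℝ)) i]
  norm_num

theorem ae_cellMeasure_iff {p : EuclideanSpace ℝ (Fin n) → Prop} :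
    (∀ᵐ x ∂cellMeasure b, p x) ↔ ∀ᵐ x ∂volume.restrict (unitCell b), p x := by
  rw [cellMeasure, Measure.ae_ennreal_smul_measure_iff]
  simp [volume_unitCell_ne_top b]

theorem measurePreserving_ofTorus :
    MeasurePreserving (ofTorus b) (volume : Measure (UnitAddTorus (Fin n))) (cellMeasure b) := by
  refine ⟨measurable_ofTorus b, ?_⟩
  rw [← (measurePreserving_toTorus b).map_eq,
    Measure.map_map (measurable_ofTorus b) (measurePreserving_toTorus b).measurable]
  have : (ofTorus b ∘ toTorus b) =ᵐ[cellMeasure b] id :=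
    (ae_cellMeasure_iff b).2
      ((ae_restrict_iff' (measurableSet_unitCell b)).2 (ae_of_all _ fun x hx => ofTorus_toTorus b hx))
  rw [Measure.map_congr this, Measure.map_id]

instance : IsProbabilityMeasure (cellMeasure b) := by
  constructor
  rw [cellMeasure, Measure.smul_apply, Measure.restrict_apply_univ, smul_eq_mul,
    ENNReal.inv_mul_cancel (volume_unitCell_ne_zero b) (volume_unitCell_ne_top b)]

theorem average_unitCell {V : Type*} [NormedAddCommGroup V] [NormedSpace ℝ V]
    (f : EuclideanSpace ℝ (Fin n) → V) :
    ⨍ x in unitCell b, f x = ∫ x, f x ∂cellMeasure b := by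
  rw [average, cellMeasure, Measure.restrict_apply_univ]

theorem integral_cellMeasure {V : Type*} [NormedAddCommGroup V] [NormedSpace ℝ V]
    (f : EuclideanSpace ℝ (Fin n) → V) :
    ∫ x in unitCell b, f x = volume.real (unitCell b) • ∫ x, f x ∂cellMeasure b := by
  rw [cellMeasure, integral_smul_measure, smul_smul, Measure.real, ENNReal.toReal_inv,
    mul_inv_cancel₀, one_smul]
  exact ENNReal.toReal_ne_zero.2 ⟨volume_unitCell_ne_zero b, volume_unitCell_ne_top b⟩

end Torus

/-! ### Fourier series of periodic functions -/

section Fourier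

attribute [local instance] instMeasureSpaceUnitAddCircle

open UnitAddTorus ComplexConjugate

variable {n : ℕ} (b : Module.Basis (Fin n) ℝ (EuclideanSpace ℝ (Fin n)))

/-- The linear form `x ↦ 2π ∑ kⱼ xⱼ`, where `xⱼ` are the coordinates of `x` in the basis `b`. -/
noncomputable def phase (k : Fin n → ℤ) : EuclideanSpace ℝ (Fin n) →L[ℝ] ℝ :=
  ∑ j, (2 * Real.pi * k j) • LinearMap.toContinuousLinearMap (b.coord j)

theorem phase_apply (k : Fin n → ℤ) (x : EuclideanSpace ℝ (Fin n)) :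
    phase b k x = ∑ j, 2 * Real.pi * k j * b.repr x j := by
  simp [phase]

/-- The character `exp (2πi ∑ kⱼ xⱼ)`. -/
noncomputable def latticeChar (k : Fin n → ℤ) (x : EuclideanSpace ℝ (Fin n)) : ℂ :=
  Complex.exp ((phase b k x : ℂ) * Complex.I)

/-- The components of the dual lattice vector `k`. -/
noncomputable def freq (k : Fin n → ℤ) (i : Fin n) : ℝ := phase b k (EuclideanSpace.single i 1)

/-- Fourier coefficients. -/
noncomputable def coeff (f : EuclideanSpace ℝ (Fin n) → ℂ) (k : Fin n → ℤ) : ℂ :=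
  ∫ x, conj (latticeChar b k x) * f x ∂cellMeasure b

theorem latticeChar_eq_mFourier (k : Fin n → ℤ) (x : EuclideanSpace ℝ (Fin n)) :
    latticeChar b k x = mFourier k (toTorus b x) := by
  simp only [mFourier, ContinuousMap.coe_mk, toTorus, fourier_coe_apply]
  rw [latticeChar, phase_apply, ← Complex.exp_sum]
  congr 1
  push_cast
  rw [Finset.sum_mul]
  refine Finset.sum_congr rfl fun j _ => ?_
  ring

theorem norm_latticeChar (k : Fin n → ℤ) (x : EuclideanSpace ℝ (Fin n)) :
    ‖latticeChar b k x‖ = 1 := by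
  rw [latticeChar, Complex.norm_exp_ofReal_mul_I]

theorem latticeChar_zero (x : EuclideanSpace ℝ (Fin n)) : latticeChar b 0 x = 1 := by
  simp [latticeChar, phase_apply]

theorem latticeChar_add_latticePoint (k m : Fin n → ℤ) (x : EuclideanSpace ℝ (Fin n)) :
    latticeChar b k (x + latticePoint b m) = latticeChar b k x := by
  simp only [latticeChar_eq_mFourier, toTorus_add_latticePoint]

theorem contDiff_latticeChar (k : Fin n → ℤ) : ContDiff ℝ ∞ (latticeChar b k) := by
  unfold latticeChar
  exact ((Complex.ofRealCLM.contDiff.comp (phase b k).contDiff).mul contDiff_const).cexp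

theorem continuous_latticeChar (k : Fin n → ℤ) : Continuous (latticeChar b k) :=
  (contDiff_latticeChar b k).continuous

theorem fderiv_latticeChar (k : Fin n → ℤ) (x v : EuclideanSpace ℝ (Fin n)) :
    fderiv ℝ (latticeChar b k) x v = Complex.I * phase b k v * latticeChar b k x := by
  have h1 : HasFDerivAt (fun x => (phase b k x : ℂ) * Complex.I)
      ((Complex.I : ℂ) • (Complex.ofRealCLM.comp (phase b k))) x :=
    ((Complex.ofRealCLM.hasFDerivAt (x := phase b k x)).comp x
      (phase b k).hasFDerivAt).mul_const Complex.I
  have h2 := h1.cexp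
  rw [show latticeChar b k = fun x => Complex.exp ((phase b k x : ℂ) * Complex.I) from rfl,
    h2.fderiv]
  simp
  ring

theorem integral_cellMeasure_eq_torus {f : EuclideanSpace ℝ (Fin n) → ℂ}
    (hf : AEStronglyMeasurable f (cellMeasure b)) :
    ∫ x, f x ∂cellMeasure b = ∫ t : UnitAddTorus (Fin n), f (ofTorus b t) := by
  have h := (measurePreserving_ofTorus b).map_eq
  conv_lhs => rw [← h]
  rw [integral_map (measurable_ofTorus b).aemeasurable]
  rwa [h]

theorem mFourierCoeff_comp_ofTorus {f : EuclideanSpace ℝ (Fin n) → ℂ}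
    (hf : AEStronglyMeasurable f (cellMeasure b)) (k : Fin n → ℤ) :
    mFourierCoeff (fun t => f (ofTorus b t)) k = coeff b f k := by
  rw [coeff, integral_cellMeasure_eq_torus, mFourierCoeff]
  · simp only [latticeChar_eq_mFourier, toTorus_ofTorus, mFourier_neg, smul_eq_mul]
  · exact (Complex.continuous_conj.comp (continuous_latticeChar b k)).aestronglyMeasurable.mul hf

/-- Parseval's identity. -/
theorem hasSum_coeff {f g : EuclideanSpace ℝ (Fin n) → ℂ} (hf : MemLp f 2 (cellMeasure b))
    (hg : MemLp g 2 (cellMeasure b)) :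
    HasSum (fun k => conj (coeff b f k) * coeff b g k) (∫ x, conj (f x) * g x ∂cellMeasure b) := by
  have hf' := hf.comp_measurePreserving (measurePreserving_ofTorus b)
  have hg' := hg.comp_measurePreserving (measurePreserving_ofTorus b)
  have h := hasSum_prod_mFourierCoeff hf'.toLp hg'.toLp
  have e : ∀ {h : EuclideanSpace ℝ (Fin n) → ℂ} (hh : MemLp h 2 (cellMeasure b)) (k),
      mFourierCoeff (hh.comp_measurePreserving (measurePreserving_ofTorus b)).toLp k
        = coeff b h k := by
    intro h hh k
    rw [← mFourierCoeff_comp_ofTorus b hh.1]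
    refine integral_congr_ae ?_
    filter_upwards [(hh.comp_measurePreserving (measurePreserving_ofTorus b)).coeFn_toLp] with t ht
    rw [ht]; rfl
  simp only [e hf, e hg] at h
  convert! h using 1
  rw [integral_cellMeasure_eq_torus b (f := fun x => conj (f x) * g x)
    ((Complex.continuous_conj.comp_aestronglyMeasurable hf.1).mul hg.1)]
  refine integral_congr_ae ?_
  filter_upwards [hf'.coeFn_toLp, hg'.coeFn_toLp] with t ht ht'
  rw [ht, ht']; rfl

/-- The Riesz–Fischer theorem. -/
theorem exists_coeff_eq {c : (Fin n → ℤ) → ℂ} (hc : Summable fun k => ‖c k‖ ^ 2) :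
    ∃ f : EuclideanSpace ℝ (Fin n) → ℂ, Measurable f ∧
      (∀ x m, f (x + latticePoint b m) = f x) ∧ MemLp f 2 (cellMeasure b) ∧
      ∀ k, coeff b f k = c k := by
  have hc' : Memℓp c 2 := by
    refine memℓp_gen ?_
    simpa using hc
  -- Composing a measurable representative of this L² class with the projection to the torus gives a
  -- function that is periodic at every point, not merely almost everywhere.
  set F := (mFourierBasis (d := Fin n)).repr.symm ⟨c, hc'⟩ with hF
  have hFm := (Lp.stronglyMeasurable F).measurable
  have hFL := (Lp.memLp F)
  refine ⟨fun x => F (toTorus b x), hFm.comp (continuous_toTorus b).measurable, ?_,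
    hFL.comp_measurePreserving (measurePreserving_toTorus b), fun k => ?_⟩
  · intro x m
    simp only [toTorus_add_latticePoint]
  · rw [← mFourierCoeff_comp_ofTorus b (f := fun x => F (toTorus b x))
      (hFL.comp_measurePreserving (measurePreserving_toTorus b)).1]
    simp only [toTorus_ofTorus]
    rw [← mFourierBasis_repr, hF, LinearIsometryEquiv.apply_symm_apply]

/-- Parseval's identity for the difference. -/
theorem ae_eq_of_coeff_eq {f g : EuclideanSpace ℝ (Fin n) → ℂ} (hf : MemLp f 2 (cellMeasure b))
    (hg : MemLp g 2 (cellMeasure b)) (h : ∀ k, coeff b f k = coeff b g k) :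
    f =ᵐ[cellMeasure b] g := by
  have hint : ∀ {u : EuclideanSpace ℝ (Fin n) → ℂ} (_ : MemLp u 2 (cellMeasure b)) (k),
      Integrable (fun x => conj (latticeChar b k x) * u x) (cellMeasure b) := by
    intro u hu k
    refine (hu.integrable (by norm_num)).bdd_mul (c := 1)
      (Complex.continuous_conj.comp (continuous_latticeChar b k)).aestronglyMeasurable
      (ae_of_all _ fun x => ?_)
    rw [RCLike.norm_conj, norm_latticeChar]
  have h0 : ∀ k, coeff b (f - g) k = 0 := by
    intro k
    have : coeff b (f - g) k = coeff b f k - coeff b g k := by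
      simp only [coeff, Pi.sub_apply, mul_sub]
      rw [integral_sub (hint hf k) (hint hg k)]
    rw [this, h, sub_self]
  have hs := hasSum_coeff b (hf.sub hg) (hf.sub hg)
  simp only [h0, map_zero, mul_zero] at hs
  have hz := hs.unique hasSum_zero
  have e : (fun x => conj ((f - g) x) * (f - g) x) = fun x => ((‖(f - g) x‖ ^ 2 : ℝ) : ℂ) := by
    funext x
    rw [Complex.conj_mul']; push_cast; rfl
  rw [e, integral_complex_ofReal] at hz
  have hz' : ∫ x, ‖(f - g) x‖ ^ 2 ∂cellMeasure b = 0 := by exact_mod_cast hz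
  rw [integral_eq_zero_iff_of_nonneg (fun x => by positivity) (hf.sub hg).norm.integrable_sq] at hz'
  filter_upwards [hz'] with x hx
  simpa [sub_eq_zero] using hx

end Fourier

/-! ### Unfolding integrals of periodic functions -/

section Unfolding

open ComplexConjugate

variable {n : ℕ} (b : Module.Basis (Fin n) ℝ (EuclideanSpace ℝ (Fin n)))

/-- The lattice points that are needed to cover the box of size `M`. -/
noncomputable def latticeBox (n M : ℕ) : Finset (Fin n → ℤ) :=
  Fintype.piFinset fun _ => Finset.Icc (-((M : ℤ) + 1)) (M + 1)

theorem fundamentalDomain_ae_eq_unitCell : ZSpan.fundamentalDomain b =ᵐ[volume] unitCell b := by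
  have hm : Measurable (b.equivFunL : EuclideanSpace ℝ (Fin n) → Fin n → ℝ) :=
    b.equivFunL.continuous.measurable
  have : (Measure.map b.equivFunL (volume : Measure (EuclideanSpace ℝ (Fin n)))).IsAddHaarMeasure :=
    b.equivFunL.isAddHaarMeasure_map volume
  have hq : Measure.QuasiMeasurePreserving
      (b.equivFunL : EuclideanSpace ℝ (Fin n) → Fin n → ℝ) volume volume :=
    ⟨hm, Measure.absolutelyContinuous_isAddHaarMeasure _ _⟩
  have h := hq.preimage_ae_eq ((Measure.univ_pi_Ico_ae_eq_Icc (ι := Fin n) (μ := fun _ => volume)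
    (f := fun _ => (0 : ℝ)) (g := fun _ => 1)).trans
      (Measure.univ_pi_Ioo_ae_eq_Icc (μ := fun _ => volume)).symm)
  have e1 : ZSpan.fundamentalDomain b =
      b.equivFunL ⁻¹' Set.univ.pi fun _ => Set.Ico (0 : ℝ) 1 := by
    ext x; simp [ZSpan.fundamentalDomain, Set.mem_pi]
  have e2 : unitCell b = b.equivFunL ⁻¹' Set.univ.pi fun _ => Set.Ioo (0 : ℝ) 1 := by
    ext x; simp [unitCell, Set.mem_pi]
  rwa [e1, e2]

theorem exists_box {K : Set (EuclideanSpace ℝ (Fin n))} (hK : IsCompact K) :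
    ∃ M : ℕ, ∀ x ∈ K, ∀ i, |b.repr x i| ≤ M := by
  have : ∀ i, ∃ C : ℝ, ∀ x ∈ K, |b.repr x i| ≤ C := fun i =>
    hK.exists_bound_of_continuousOn (continuous_repr b i).continuousOn
  choose C hC using this
  obtain ⟨M, hM⟩ := exists_nat_ge (∑ i, |C i|)
  refine ⟨M, fun x hx i => (hC i x hx).trans ((le_abs_self _).trans (le_trans ?_ hM))⟩
  exact Finset.single_le_sum (f := fun i => |C i|) (fun i _ => abs_nonneg _) (Finset.mem_univ i)

theorem isCompact_box (R : ℝ) :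
    IsCompact {x : EuclideanSpace ℝ (Fin n) | ∀ i, |b.repr x i| ≤ R} := by
  have h : {x : EuclideanSpace ℝ (Fin n) | ∀ i, |b.repr x i| ≤ R} =
      b.equivFunL.toHomeomorph ⁻¹' (Set.univ.pi fun _ => Set.Icc (-R) R) := by
    ext x; simp [abs_le, Pi.le_def, forall_and]
  rw [h, b.equivFunL.toHomeomorph.isCompact_preimage]
  exact isCompact_univ_pi fun _ => isCompact_Icc

/-- The translate of the fundamental domain by a lattice point. -/
def cellAt (m : Fin n → ℤ) : Set (EuclideanSpace ℝ (Fin n)) :=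
  {x | ∀ i, ⌊b.repr x i⌋ = m i}

theorem measurableSet_cellAt (m : Fin n → ℤ) : MeasurableSet (cellAt b m) := by
  have : cellAt b m = ⋂ i, {x | ⌊b.repr x i⌋ = m i} := by ext x; simp [cellAt]
  rw [this]
  refine MeasurableSet.iInter fun i => ?_
  exact (Int.measurable_floor.comp (continuous_repr b i).measurable) (measurableSet_singleton (m i))

theorem cellAt_preimage (m : Fin n → ℤ) :
    (fun x => x + latticePoint b m) ⁻¹' cellAt b m = ZSpan.fundamentalDomain b := by
  ext x
  simp only [cellAt, Set.mem_preimage, Set.mem_ofPred_eq, map_add, Finsupp.add_apply,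
    repr_latticePoint, Int.floor_add_intCast, ZSpan.mem_fundamentalDomain]
  refine forall_congr' fun i => ?_
  rw [add_eq_right, Int.floor_eq_zero_iff]

theorem disjoint_cellAt {m m' : Fin n → ℤ} (h : m ≠ m') : Disjoint (cellAt b m) (cellAt b m') := by
  rw [Set.disjoint_left]
  intro x hx hx'
  exact h (funext fun i => (hx i).symm.trans (hx' i))

theorem mem_biUnion_cellAt {M : ℕ} {x : EuclideanSpace ℝ (Fin n)} (hx : ∀ i, |b.repr x i| ≤ M) :
    x ∈ ⋃ m ∈ latticeBox n M, cellAt b m := by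
  simp only [Set.mem_iUnion]
  refine ⟨fun i => ⌊b.repr x i⌋, ?_, fun i => rfl⟩
  simp only [latticeBox, Fintype.mem_piFinset, Finset.mem_Icc]
  intro i
  have h := abs_le.1 (hx i)
  constructor
  · rw [Int.le_floor]; push_cast; linarith
  · exact Int.floor_le_iff.2 (by push_cast; linarith)

theorem setIntegral_cellAt (m : Fin n → ℤ) (F : EuclideanSpace ℝ (Fin n) → ℂ) :
    ∫ x in cellAt b m, F x = ∫ x in unitCell b, F (x + latticePoint b m) := by
  have h := (measurePreserving_add_right volume (latticePoint b m)).setIntegral_preimage_emb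
    (MeasurableEquiv.addRight (latticePoint b m)).measurableEmbedding F (cellAt b m)
  rw [← h, cellAt_preimage, setIntegral_congr_set (fundamentalDomain_ae_eq_unitCell b)]

theorem integrableOn_cellAt (m : Fin n → ℤ) (F : EuclideanSpace ℝ (Fin n) → ℂ) :
    IntegrableOn F (cellAt b m) ↔
      IntegrableOn (fun x => F (x + latticePoint b m)) (unitCell b) := by
  have h := (measurePreserving_add_right volume (latticePoint b m)).integrableOn_comp_preimage
    (MeasurableEquiv.addRight (latticePoint b m)).measurableEmbedding (f := F) (s := cellAt b m)
  rw [← h, cellAt_preimage, integrableOn_congr_set_ae (fundamentalDomain_ae_eq_unitCell b)]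
  rfl

/-- `f` is periodic, up to null sets. -/
def AEPeriodic {V : Type*} (f : EuclideanSpace ℝ (Fin n) → V) : Prop :=
  ∀ m, ∀ᵐ x, f (x + latticePoint b m) = f x

/-- The periodization of a function that is supported in the box of size `M`. -/
noncomputable def periodize (M : ℕ) (φ : EuclideanSpace ℝ (Fin n) → ℂ)
    (x : EuclideanSpace ℝ (Fin n)) : ℂ :=
  ∑ m ∈ latticeBox n M, φ (x + latticePoint b m)

theorem integrable_cellMeasure_iff {V : Type*} [NormedAddCommGroup V]
    {f : EuclideanSpace ℝ (Fin n) → V} :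
    Integrable f (cellMeasure b) ↔ IntegrableOn f (unitCell b) := by
  rw [cellMeasure, integrable_smul_measure (by simp [volume_unitCell_ne_top])
    (by simp [volume_unitCell_ne_zero])]
  rfl

/-- Cutting ℝⁿ into lattice translates of the cell moves the sum over translates from the integral
onto φ. This is the bridge between test functions on ℝⁿ and Fourier analysis on the cell. -/
theorem integral_mul_eq_periodize {f φ : EuclideanSpace ℝ (Fin n) → ℂ} (hf : AEPeriodic b f)
    {M : ℕ} (hφ : ∀ x, φ x ≠ 0 → ∀ i, |b.repr x i| ≤ M) (hint : Integrable fun x => f x * φ x) :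
    ∫ x, f x * φ x =
      volume.real (unitCell b) • ∫ x, f x * periodize b M φ x ∂cellMeasure b := by
  have h1 : ∫ x, f x * φ x = ∫ x in ⋃ m ∈ latticeBox n M, cellAt b m, f x * φ x := by
    refine (setIntegral_eq_integral_of_forall_compl_eq_zero fun x hx => ?_).symm
    by_contra h
    exact hx (mem_biUnion_cellAt b (hφ x (right_ne_zero_of_mul h)))
  have hper : ∀ m : Fin n → ℤ, (fun x => f (x + latticePoint b m) * φ (x + latticePoint b m))
      =ᵐ[volume.restrict (unitCell b)] fun x => f x * φ (x + latticePoint b m) := by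
    intro m
    refine ae_restrict_of_ae ?_
    filter_upwards [hf m] with x hx
    rw [hx]
  rw [h1, integral_biUnion_finset _ (fun m _ => measurableSet_cellAt b m)
    (fun m _ m' _ h => disjoint_cellAt b h) (fun m _ => hint.integrableOn),
    ← integral_cellMeasure]
  simp only [periodize, Finset.mul_sum]
  rw [integral_finsetSum]
  · refine Finset.sum_congr rfl fun m _ => ?_
    rw [setIntegral_cellAt, integral_congr_ae (hper m)]
  · intro m _
    have h2 := (integrableOn_cellAt b m _).1 (hint.integrableOn (s := cellAt b m))
    exact (integrable_congr (hper m)).1 h2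

/-! ### Periodic square integrable functions -/

/-- `f` is periodic (up to null sets) and locally square integrable. -/
structure PerL2 (f : EuclideanSpace ℝ (Fin n) → ℂ) : Prop where
  periodic : AEPeriodic b f
  memLp : ∀ K, IsCompact K → MemLp f 2 (volume.restrict K)

variable {b}

theorem unitCell_subset_box : unitCell b ⊆ {x | ∀ i, |b.repr x i| ≤ 1} := fun x hx i =>
  abs_le.2 ⟨by linarith [(hx i).1], (hx i).2.le⟩

theorem memLp_cellMeasure_of_compact {V : Type*} [NormedAddCommGroup V]
    {f : EuclideanSpace ℝ (Fin n) → V}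
    (hf : ∀ K, IsCompact K → MemLp f 2 (volume.restrict K)) : MemLp f 2 (cellMeasure b) := by
  have h := (hf _ (isCompact_box b 1)).mono_measure
    (Measure.restrict_mono (unitCell_subset_box (b := b)) le_rfl)
  exact h.smul_measure (by simp [volume_unitCell_ne_zero])

theorem PerL2.memLp_cell {f : EuclideanSpace ℝ (Fin n) → ℂ} (hf : PerL2 b f) :
    MemLp f 2 (cellMeasure b) := memLp_cellMeasure_of_compact hf.memLp

theorem locallyIntegrable_of_compact {V : Type*} [NormedAddCommGroup V]
    {f : EuclideanSpace ℝ (Fin n) → V}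
    (hf : ∀ K, IsCompact K → MemLp f 2 (volume.restrict K)) : LocallyIntegrable f volume := by
  rw [locallyIntegrable_iff]
  intro K hK
  have : IsFiniteMeasure (volume.restrict K) := ⟨by simpa using hK.measure_lt_top⟩
  exact (hf K hK).integrable (by norm_num)

theorem PerL2.of_memLp {f : EuclideanSpace ℝ (Fin n) → ℂ} (hm : Measurable f)
    (hp : ∀ x m, f (x + latticePoint b m) = f x) (hf : MemLp f 2 (cellMeasure b)) : PerL2 b f := by
  refine ⟨fun m => ae_of_all _ fun x => hp x m, fun K hK => ?_⟩
  obtain ⟨M, hM⟩ := exists_box b hK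
  -- The squared norm is viewed as complex-valued so that `integrableOn_cellAt` applies to it.
  have h0 : IntegrableOn (fun x => ((‖f x‖ ^ 2 : ℝ) : ℂ)) (unitCell b) :=
    ((integrable_cellMeasure_iff b).1 hf.norm.integrable_sq).ofReal
  have h1 : IntegrableOn (fun x => ((‖f x‖ ^ 2 : ℝ) : ℂ)) (⋃ m ∈ latticeBox n M, cellAt b m) := by
    rw [integrableOn_finset_iUnion]
    intro m _
    rw [integrableOn_cellAt]
    simpa only [hp] using h0
  have h2 := h1.mono_set (s := K) fun x hx => mem_biUnion_cellAt b (hM x hx)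
  rw [memLp_two_iff_integrable_sq_norm hm.aestronglyMeasurable]
  have h3 := h2.re
  simpa only [RCLike.re_to_complex, Complex.ofReal_re] using h3

end Unfolding

/-! ### A periodic partition of unity -/

section Partition

open ComplexConjugate

variable {n : ℕ} (b : Module.Basis (Fin n) ℝ (EuclideanSpace ℝ (Fin n)))

/-- A smooth bump function on the line whose integer translates sum to one. -/
noncomputable def bump (t : ℝ) : ℝ := Real.smoothTransition (t + 1) - Real.smoothTransition t

theorem contDiff_bump : ContDiff ℝ ∞ bump :=
  (Real.smoothTransition.contDiff.comp (contDiff_id.add contDiff_const)).sub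
    Real.smoothTransition.contDiff

theorem abs_le_of_bump_ne_zero {t : ℝ} (h : bump t ≠ 0) : |t| ≤ 1 := by
  by_contra! h'
  apply h
  rcases lt_abs.1 h' with h1 | h1
  · rw [bump, Real.smoothTransition.one_of_one_le (by linarith),
      Real.smoothTransition.one_of_one_le (by linarith), sub_self]
  · rw [bump, Real.smoothTransition.zero_of_nonpos (by linarith),
      Real.smoothTransition.zero_of_nonpos (by linarith), sub_self]

theorem sum_bump {t : ℝ} (h : |t| < 2) :
    ∑ m ∈ Finset.Icc (-(((1 : ℕ) : ℤ) + 1)) (((1 : ℕ) : ℤ) + 1), bump (t + m) = 1 := by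
  have h' := abs_lt.1 h
  have e : Finset.Icc (-(((1 : ℕ) : ℤ) + 1)) (((1 : ℕ) : ℤ) + 1) = {-2, -1, 0, 1, 2} := by
    decide
  rw [e]
  simp only [bump]
  rw [Finset.sum_insert (by decide), Finset.sum_insert (by decide), Finset.sum_insert (by decide),
    Finset.sum_insert (by decide), Finset.sum_singleton]
  -- The sum telescopes: only the values at t + 3 and t − 2 survive, and these are 1 and 0 when |t|
  -- < 2.
  have e1 : Real.smoothTransition (t + ((2 : ℤ) : ℝ) + 1) = 1 :=
    Real.smoothTransition.one_of_one_le (by push_cast; linarith)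
  have e2 : Real.smoothTransition (t + ((-2 : ℤ) : ℝ)) = 0 :=
    Real.smoothTransition.zero_of_nonpos (by push_cast; linarith)
  rw [e1, e2]
  have e3 : t + ((-2 : ℤ) : ℝ) + 1 = t + ((-1 : ℤ) : ℝ) := by push_cast; ring
  have e4 : t + ((-1 : ℤ) : ℝ) + 1 = t + ((0 : ℤ) : ℝ) := by push_cast; ring
  have e5 : t + ((0 : ℤ) : ℝ) + 1 = t + ((1 : ℤ) : ℝ) := by push_cast; ring
  have e6 : t + ((1 : ℤ) : ℝ) + 1 = t + ((2 : ℤ) : ℝ) := by push_cast; ring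
  rw [e3, e4, e5, e6]
  ring

/-- A smooth compactly supported function whose lattice translates sum to one. -/
noncomputable def latticeBump (x : EuclideanSpace ℝ (Fin n)) : ℝ := ∏ i, bump (b.repr x i)

theorem contDiff_latticeBump : ContDiff ℝ ∞ (latticeBump b) :=
  contDiff_prod fun i _ => contDiff_bump.comp
    (LinearMap.toContinuousLinearMap (b.coord i)).contDiff

theorem abs_le_of_latticeBump_ne_zero {x : EuclideanSpace ℝ (Fin n)} (h : latticeBump b x ≠ 0)
    (i : Fin n) : |b.repr x i| ≤ 1 :=
  abs_le_of_bump_ne_zero (Finset.prod_ne_zero_iff.1 h i (Finset.mem_univ i))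

theorem sum_latticeBump {x : EuclideanSpace ℝ (Fin n)} (h : ∀ i, |b.repr x i| < 2) :
    ∑ m ∈ latticeBox n 1, latticeBump b (x + latticePoint b m) = 1 := by
  simp only [latticeBump, map_add, Finsupp.add_apply, repr_latticePoint, latticeBox]
  rw [← Finset.prod_univ_sum (fun _ => Finset.Icc (-(((1 : ℕ) : ℤ) + 1)) (((1 : ℕ) : ℤ) + 1))
    (fun i m => bump (b.repr x i + m))]
  exact Finset.prod_eq_one fun i _ => sum_bump (h i)

theorem hasCompactSupport_of_box {φ : EuclideanSpace ℝ (Fin n) → ℂ} {R : ℝ}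
    (h : ∀ x, φ x ≠ 0 → ∀ i, |b.repr x i| ≤ R) : HasCompactSupport φ :=
  HasCompactSupport.of_support_subset_isCompact (isCompact_box b R) fun x hx => h x hx

theorem fderiv_support_box {φ : EuclideanSpace ℝ (Fin n) → ℂ} {R : ℝ}
    (h : ∀ x, φ x ≠ 0 → ∀ i, |b.repr x i| ≤ R) (v x : EuclideanSpace ℝ (Fin n))
    (hx : fderiv ℝ φ x v ≠ 0) (i : Fin n) : |b.repr x i| ≤ R := by
  have h1 : x ∈ tsupport φ := by
    apply support_fderiv_subset ℝ
    intro h0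
    rw [h0] at hx
    exact hx rfl
  have h2 : tsupport φ ⊆ {x | ∀ i, |b.repr x i| ≤ R} :=
    closure_minimal (fun x hx => h x hx) (isCompact_box b R).isClosed
  exact h2 h1 i

/-- A periodic function cannot be a test function, but its product with `latticeBump` can, and
periodizing that product restores it. The identity holds on an open set, so it may be
differentiated. -/
theorem exists_periodize_eq {ψ : EuclideanSpace ℝ (Fin n) → ℂ} (hψ : ContDiff ℝ ∞ ψ)
    (hper : ∀ x m, ψ (x + latticePoint b m) = ψ x) :
    ∃ φ : EuclideanSpace ℝ (Fin n) → ℂ, ContDiff ℝ ∞ φ ∧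
      (∀ x, φ x ≠ 0 → ∀ i, |b.repr x i| ≤ (1 : ℕ)) ∧
      (∀ x ∈ unitCell b, periodize b 1 φ x = ψ x) ∧
      ∀ v, ∀ x ∈ unitCell b, periodize b 1 (fun x => fderiv ℝ φ x v) x = fderiv ℝ ψ x v := by
  have hcd : ContDiff ℝ ∞ fun x => (latticeBump b x : ℂ) * ψ x :=
    (Complex.ofRealCLM.contDiff.comp (contDiff_latticeBump b)).mul hψ
  have hU : ∀ x : EuclideanSpace ℝ (Fin n), (∀ i, |b.repr x i| < 2) →
      periodize b 1 (fun x => (latticeBump b x : ℂ) * ψ x) x = ψ x := by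
    intro x hx
    simp only [periodize, hper, ← Finset.sum_mul]
    have := sum_latticeBump b hx
    rw [← Complex.ofReal_sum, this, Complex.ofReal_one, one_mul]
  have hlt : ∀ x ∈ unitCell b, ∀ i, |b.repr x i| < 2 := fun x hx i =>
    abs_lt.2 ⟨by linarith [(hx i).1], by linarith [(hx i).2]⟩
  refine ⟨_, hcd, ?_, fun x hx => hU x (hlt x hx), fun v x hx => ?_⟩
  · intro x hx i
    rw [Nat.cast_one]
    exact abs_le_of_latticeBump_ne_zero b (fun h => hx (by simp [h])) i
  · have hev : periodize b 1 (fun x => (latticeBump b x : ℂ) * ψ x) =ᶠ[nhds x] ψ := by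
      filter_upwards [(isOpen_unitCell b).mem_nhds hx] with y hy using hU y (hlt y hy)
    rw [← hev.fderiv_eq]
    have hd : ∀ m ∈ latticeBox n 1, DifferentiableAt ℝ
        (fun x => (fun x => (latticeBump b x : ℂ) * ψ x) (x + latticePoint b m)) x := by
      intro m _
      exact (hcd.differentiable (by simp)).differentiableAt.comp x
        (differentiableAt_id.add_const _)
    have e : fderiv ℝ (periodize b 1 (fun x => (latticeBump b x : ℂ) * ψ x)) x =
      ∑ m ∈ latticeBox n 1, fderiv ℝ (fun x => (latticeBump b x : ℂ) * ψ x)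
        (x + latticePoint b m) := by
      unfold periodize
      rw [fderiv_fun_sum hd]
      refine Finset.sum_congr rfl fun m _ => ?_
      exact fderiv_comp_add_right (f := fun x => (latticeBump b x : ℂ) * ψ x) _
    rw [e, _root_.sum_apply]
    rfl

end Partition

/-! ### Weak derivatives and Fourier coefficients -/

section WeakFourier

open ComplexConjugate

variable {n : ℕ} {b : Module.Basis (Fin n) ℝ (EuclideanSpace ℝ (Fin n))}

theorem integrable_mul_of_box {f φ : EuclideanSpace ℝ (Fin n) → ℂ}
    (hf : LocallyIntegrable f volume) (hφ : Continuous φ) (hc : HasCompactSupport φ) :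
    Integrable fun x => f x * φ x := by
  have := hf.integrable_smul_left_of_hasCompactSupport hφ hc
  simpa only [smul_eq_mul, mul_comm] using this

theorem LocL2.ofReal {f : EuclideanSpace ℝ (Fin n) → ℝ} (hf : LocL2 f) (K) (hK : IsCompact K) :
    MemLp (fun x => (f x : ℂ)) 2 (volume.restrict K) := (hf K hK).ofReal

theorem fderiv_continuous_apply {V : Type*} [NormedAddCommGroup V] [NormedSpace ℝ V]
    {φ : EuclideanSpace ℝ (Fin n) → V} (hφ : ContDiff ℝ ∞ φ)
    (v : EuclideanSpace ℝ (Fin n)) : Continuous fun x => fderiv ℝ φ x v :=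
  (hφ.continuous_fderiv (by simp)).clm_apply continuous_const

theorem IsWeakPartial.integral_complex {i : Fin n} {f g : EuclideanSpace ℝ (Fin n) → ℝ}
    (h : IsWeakPartial i f g) (hf : LocL2 f) (hg : LocL2 g) {φ : EuclideanSpace ℝ (Fin n) → ℂ}
    (hφ : ContDiff ℝ ∞ φ) (hc : HasCompactSupport φ) :
    ∫ x, (f x : ℂ) * fderiv ℝ φ x (EuclideanSpace.single i 1) = -∫ x, (g x : ℂ) * φ x := by
  have hi1 : Integrable fun x => (f x : ℂ) * fderiv ℝ φ x (EuclideanSpace.single i 1) :=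
    integrable_mul_of_box (locallyIntegrable_of_compact hf.ofReal) (fderiv_continuous_apply hφ _)
      (hc.fderiv_apply ℝ _)
  have hi2 : Integrable fun x => (g x : ℂ) * φ x :=
    integrable_mul_of_box (locallyIntegrable_of_compact hg.ofReal) hφ.continuous hc
  have key : ∀ L : ℂ →L[ℝ] ℝ, (∀ (r : ℝ) (z : ℂ), L (r * z) = r * L z) →
      L (∫ x, (f x : ℂ) * fderiv ℝ φ x (EuclideanSpace.single i 1)) =
        L (-∫ x, (g x : ℂ) * φ x) := by
    intro L hL
    rw [map_neg, ← L.integral_comp_comm hi1, ← L.integral_comp_comm hi2]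
    simp only [hL]
    rw [← h (fun x => L (φ x)) (L.contDiff.comp hφ) (hc.comp_left (map_zero L))]
    refine integral_congr_ae (ae_of_all _ fun x => ?_)
    have : fderiv ℝ (fun x => L (φ x)) x = L.comp (fderiv ℝ φ x) :=
      (L.hasFDerivAt.comp x (hφ.differentiable (by simp)).differentiableAt.hasFDerivAt).fderiv
    simp only [this, ContinuousLinearMap.comp_apply]
  exact Complex.ext (key Complex.reCLM fun r z => by simp) (key Complex.imCLM fun r z => by simp)

theorem IsPeriodic.add_latticePoint {f : EuclideanSpace ℝ (Fin n) → ℝ} (hf : IsPeriodic b f)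
    (x : EuclideanSpace ℝ (Fin n)) (m : Fin n → ℤ) : f (x + latticePoint b m) = f x := by
  have key : ∀ (s : Finset (Fin n)) (x), f (x + ∑ i ∈ s, (m i : ℝ) • b i) = f x := by
    intro s
    induction s using Finset.induction_on with
    | empty => intro x; simp
    | insert i s hi ih =>
      intro x
      rw [Finset.sum_insert hi, ← add_assoc, ih]
      have h : Function.Periodic f (b i) := hf i
      have := h.zsmul (m i) x
      rwa [← Int.cast_smul_eq_zsmul ℝ] at this
  exact key Finset.univ x

/-- Translating the test function shows that g and its lattice translate have the same integrals
against all test functions. Periodicity of a weak derivative is a consequence, so the Sobolev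
structures need not assume it. -/
theorem IsWeakPartial.aePeriodic {i : Fin n} {f g : EuclideanSpace ℝ (Fin n) → ℝ}
    (h : IsWeakPartial i f g) (hf : AEPeriodic b f) (hg : LocL2 g) : AEPeriodic b g := by
  intro m
  have hgi : LocallyIntegrable g volume := locallyIntegrable_of_compact hg
  refine ae_eq_of_integral_contDiff_smul_eq ?_ hgi fun φ hφ hc => ?_
  · rw [locallyIntegrable_iff]
    intro K hK
    have h1 := (measurePreserving_add_right volume (latticePoint b m)).integrableOn_comp_preimage
      (MeasurableEquiv.addRight (latticePoint b m)).measurableEmbedding (f := g)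
      (s := (fun x => x + latticePoint b m) '' K)
    rw [Set.preimage_image_eq _ (add_left_injective _)] at h1
    exact h1.2 (hgi.integrableOn_isCompact (hK.image (continuous_id.add continuous_const)))
  · have hφ' : ContDiff ℝ ∞ fun x => φ (x - latticePoint b m) :=
      hφ.comp (contDiff_id.sub contDiff_const)
    have hc' : HasCompactSupport fun x => φ (x - latticePoint b m) :=
      hc.comp_homeomorph (Homeomorph.subRight (latticePoint b m))
    have e1 := h _ hφ hc
    have e2 := h _ hφ' hc'
    have e3 : ∫ x, φ x • g (x + latticePoint b m) = ∫ x, g x * φ (x - latticePoint b m) := by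
      rw [← integral_add_right_eq_self (fun x => g x * φ (x - latticePoint b m))
        (latticePoint b m)]
      simp only [add_sub_cancel_right, smul_eq_mul, mul_comm]
    have e4 : ∫ x, f x * fderiv ℝ (fun x => φ (x - latticePoint b m)) x (EuclideanSpace.single i 1)
        = ∫ x, f x * fderiv ℝ φ x (EuclideanSpace.single i 1) := by
      rw [← integral_add_right_eq_self _ (latticePoint b m)]
      refine integral_congr_ae ?_
      filter_upwards [hf m] with x hx
      rw [hx, fderiv_comp_sub, add_sub_cancel_right]
    rw [e3]
    rw [e4, e1] at e2
    simp only [smul_eq_mul, mul_comm (φ _)]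
    linarith

theorem conj_latticeChar (k : Fin n → ℤ) (x : EuclideanSpace ℝ (Fin n)) :
    conj (latticeChar b k x) = latticeChar b (-k) x := by
  rw [latticeChar, latticeChar, ← Complex.exp_conj]
  simp only [map_mul, Complex.conj_ofReal, Complex.conj_I, phase_apply, Pi.neg_apply]
  push_cast
  simp

theorem freq_neg (k : Fin n → ℤ) (i : Fin n) : freq b (-k) i = -freq b k i := by
  simp [freq, phase_apply]

theorem AEPeriodic.ofReal {f : EuclideanSpace ℝ (Fin n) → ℝ} (hf : AEPeriodic b f) :
    AEPeriodic b fun x => (f x : ℂ) := by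
  intro m
  filter_upwards [hf m] with x hx
  rw [hx]

theorem ae_cell_of_forall {p : EuclideanSpace ℝ (Fin n) → Prop} (h : ∀ x ∈ unitCell b, p x) :
    ∀ᵐ x ∂cellMeasure b, p x :=
  (ae_cellMeasure_iff b).2 ((ae_restrict_iff' (measurableSet_unitCell b)).2 (ae_of_all _ h))

theorem volume_real_unitCell_ne_zero : volume.real (unitCell b) ≠ 0 :=
  ENNReal.toReal_ne_zero.2 ⟨volume_unitCell_ne_zero b, volume_unitCell_ne_top b⟩

/-- The Fourier coefficients of a weak partial derivative. -/
theorem coeff_weakPartial {i : Fin n} {f g : EuclideanSpace ℝ (Fin n) → ℝ}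
    (h : IsWeakPartial i f g) (hf : LocL2 f) (hg : LocL2 g) (hfp : AEPeriodic b f)
    (k : Fin n → ℤ) :
    coeff b (fun x => (g x : ℂ)) k =
      Complex.I * freq b k i * coeff b (fun x => (f x : ℂ)) k := by
  obtain ⟨φ, hφ, hbox, hP, hP'⟩ := exists_periodize_eq b (contDiff_latticeChar b (-k))
    (fun x m => latticeChar_add_latticePoint b (-k) m x)
  have hc := hasCompactSupport_of_box b hbox
  have e := h.integral_complex hf hg hφ hc
  rw [integral_mul_eq_periodize b hfp.ofReal (fderiv_support_box b hbox _)
      (integrable_mul_of_box (locallyIntegrable_of_compact hf.ofReal) (fderiv_continuous_apply hφ _)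
      (hc.fderiv_apply ℝ _)),
    integral_mul_eq_periodize b (h.aePeriodic hfp hg).ofReal hbox
      (integrable_mul_of_box (locallyIntegrable_of_compact hg.ofReal) hφ.continuous hc),
    ← smul_neg] at e
  have e' := smul_right_injective ℂ (volume_real_unitCell_ne_zero (b := b)) e
  have e1 : ∫ x, (f x : ℂ) * periodize b 1 (fun x => fderiv ℝ φ x (EuclideanSpace.single i 1)) x
      ∂cellMeasure b = -(Complex.I * freq b k i) * coeff b (fun x => (f x : ℂ)) k := by
    rw [coeff, ← integral_const_mul]
    refine integral_congr_ae (ae_cell_of_forall fun x hx => ?_)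
    simp only
    rw [hP' _ x hx, fderiv_latticeChar, conj_latticeChar]
    change _ * (_ * ((freq b (-k) i : ℝ) : ℂ) * _) = _
    rw [freq_neg]
    push_cast
    ring
  have e2 : ∫ x, (g x : ℂ) * periodize b 1 φ x ∂cellMeasure b = coeff b (fun x => (g x : ℂ)) k := by
    rw [coeff]
    refine integral_congr_ae (ae_cell_of_forall fun x hx => ?_)
    simp only
    rw [hP x hx, conj_latticeChar, mul_comm]
  rw [e1, e2] at e'
  exact (neg_inj.1 ((neg_mul _ _).symm.trans e')).symm

theorem continuous_periodize {φ : EuclideanSpace ℝ (Fin n) → ℂ} (hφ : Continuous φ) (M : ℕ) :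
    Continuous (periodize b M φ) :=
  continuous_finsetSum _ fun _ _ => hφ.comp (continuous_id.add continuous_const)

theorem memLp_of_continuous {φ : EuclideanSpace ℝ (Fin n) → ℂ} (hφ : Continuous φ) :
    MemLp φ 2 (cellMeasure b) := by
  refine memLp_cellMeasure_of_compact fun K hK => ?_
  have : IsFiniteMeasure (volume.restrict K) := ⟨by simpa using hK.measure_lt_top⟩
  obtain ⟨C, hC⟩ := hK.exists_bound_of_continuousOn hφ.continuousOn
  exact MemLp.of_bound hφ.aestronglyMeasurable C
    ((ae_restrict_iff' hK.measurableSet).2 (ae_of_all _ hC))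

theorem aePeriodic_latticeChar (k : Fin n → ℤ) : AEPeriodic b (latticeChar b k) :=
  fun m => ae_of_all _ fun x => latticeChar_add_latticePoint b k m x

theorem perL2_latticeChar (k : Fin n → ℤ) : PerL2 b (latticeChar b k) :=
  PerL2.of_memLp (continuous_latticeChar b k).measurable
    (fun x m => latticeChar_add_latticePoint b k m x)
    (memLp_of_continuous (continuous_latticeChar b k))

/-- Integrals of periodic functions against test functions, in terms of Fourier coefficients. -/
theorem hasSum_integral_mul {f φ : EuclideanSpace ℝ (Fin n) → ℂ} (hf : PerL2 b f)
    (hφ : Continuous φ) {M : ℕ} (hbox : ∀ x, φ x ≠ 0 → ∀ i, |b.repr x i| ≤ M) :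
    HasSum (fun k => (∫ x, latticeChar b k x * φ x) * coeff b f k) (∫ x, f x * φ x) := by
  have hc := hasCompactSupport_of_box b hbox
  have hP : MemLp (fun x => conj (periodize b M φ x)) 2 (cellMeasure b) :=
    memLp_of_continuous (Complex.continuous_conj.comp (continuous_periodize hφ M))
  -- Parseval on the cell for f against the conjugate of the periodized φ; the coefficients of the
  -- latter unfold back to integrals of characters over ℝⁿ.
  have h1 := (hasSum_coeff b hP hf.memLp_cell).const_smul (volume.real (unitCell b))
  have e0 := integral_mul_eq_periodize b hf.periodic hbox
    (integrable_mul_of_box (locallyIntegrable_of_compact hf.memLp) hφ hc)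
  have e : ∀ k, volume.real (unitCell b) • (conj (coeff b (fun x => conj (periodize b M φ x)) k)
      * coeff b f k) = (∫ x, latticeChar b k x * φ x) * coeff b f k := by
    intro k
    rw [integral_mul_eq_periodize b (aePeriodic_latticeChar k) hbox
      (integrable_mul_of_box (locallyIntegrable_of_compact (perL2_latticeChar k).memLp) hφ hc),
      smul_mul_assoc]
    congr 2
    rw [coeff, ← integral_conj]
    simp
  simp only [e] at h1
  rw [e0]
  convert h1 using 2
  refine integral_congr_ae (ae_of_all _ fun x => ?_)
  simp [mul_comm]

/-- The weak partial derivative of a periodic function is characterized by its Fourier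
coefficients. -/
theorem integral_mul_fderiv_of_coeff {i : Fin n} {f g : EuclideanSpace ℝ (Fin n) → ℂ}
    (hf : PerL2 b f) (hg : PerL2 b g)
    (h : ∀ k, coeff b g k = Complex.I * freq b k i * coeff b f k)
    {φ : EuclideanSpace ℝ (Fin n) → ℂ} (hφ : ContDiff ℝ ∞ φ) (hc : HasCompactSupport φ) :
    ∫ x, f x * fderiv ℝ φ x (EuclideanSpace.single i 1) = -∫ x, g x * φ x := by
  obtain ⟨M, hM⟩ := exists_box b hc
  have hbox : ∀ x, φ x ≠ 0 → ∀ i, |b.repr x i| ≤ M := fun x hx =>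
    hM x (subset_tsupport φ hx)
  have h1 := hasSum_integral_mul hf (fderiv_continuous_apply hφ (EuclideanSpace.single i 1))
    (fderiv_support_box b hbox _)
  have h2 := (hasSum_integral_mul hg hφ.continuous hbox).neg
  refine h1.unique (h2.congr_fun fun k => ?_)
  -- Integration by parts is done one character at a time; the compact support of φ gives
  -- integrability.
  have e := integral_mul_fderiv_eq_neg_fderiv_mul_of_integrable (μ := volume)
    (f := latticeChar b k) (g := φ) (v := EuclideanSpace.single i 1)
    (integrable_mul_of_box ((fderiv_continuous_apply (contDiff_latticeChar b k) _).locallyIntegrable)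
      hφ.continuous hc)
    (integrable_mul_of_box (continuous_latticeChar b k).locallyIntegrable
      (fderiv_continuous_apply hφ _) (hc.fderiv_apply ℝ _))
    (integrable_mul_of_box (continuous_latticeChar b k).locallyIntegrable hφ.continuous hc)
    (fun x _ => ((contDiff_latticeChar b k).differentiable (by simp)).differentiableAt)
    (fun x _ => (hφ.differentiable (by simp)).differentiableAt)
  rw [e, h]
  simp only [fderiv_latticeChar, mul_assoc]
  rw [integral_const_mul, integral_const_mul]
  change -(Complex.I * (((freq b k i : ℝ) : ℂ) * _)) * _ = _
  ring

end WeakFourier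

/-! ### Periodic Sobolev functions -/

section Sobolev

open ComplexConjugate

variable {n : ℕ} {b : Module.Basis (Fin n) ℝ (EuclideanSpace ℝ (Fin n))}

theorem LocL2.memLp_cell {f : EuclideanSpace ℝ (Fin n) → ℝ} (hf : LocL2 f) :
    MemLp f 2 (cellMeasure b) := memLp_cellMeasure_of_compact hf

theorem hasSum_coeff_real {f g : EuclideanSpace ℝ (Fin n) → ℝ} (hf : MemLp f 2 (cellMeasure b))
    (hg : MemLp g 2 (cellMeasure b)) :
    HasSum (fun k => conj (coeff b (fun x => (f x : ℂ)) k) * coeff b (fun x => (g x : ℂ)) k)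
      ((∫ x, f x * g x ∂cellMeasure b : ℝ) : ℂ) := by
  have h := hasSum_coeff b (f := fun x => (f x : ℂ)) (g := fun x => (g x : ℂ)) hf.ofReal hg.ofReal
  simp only [Complex.conj_ofReal, ← Complex.ofReal_mul] at h
  rwa [integral_complex_ofReal] at h

theorem coeff_zero (f : EuclideanSpace ℝ (Fin n) → ℝ) :
    coeff b (fun x => (f x : ℂ)) 0 = ((∫ x, f x ∂cellMeasure b : ℝ) : ℂ) := by
  simp only [coeff, latticeChar_zero, map_one, one_mul]
  exact integral_complex_ofReal

theorem freq_zero (i : Fin n) : freq b 0 i = 0 := by simp [freq, phase_apply]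

theorem IsPeriodic.aePeriodic {f : EuclideanSpace ℝ (Fin n) → ℝ} (hf : IsPeriodic b f) :
    AEPeriodic b f := fun m => ae_of_all _ fun x => hf.add_latticePoint x m

/-! ### Periodic gradients -/

section

variable {v w : Fin n → EuclideanSpace ℝ (Fin n) → ℝ}
  {G G' : EuclideanSpace ℝ (Fin n) → Matrix (Fin n) (Fin n) ℝ}

theorem IsW12Per.coeff_grad (h : IsW12Per b v G) (p i : Fin n) (k : Fin n → ℤ) :
    coeff b (fun x => (G x p i : ℂ)) k =
      Complex.I * freq b k i * coeff b (fun x => (v p x : ℂ)) k :=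
  coeff_weakPartial (h.grad p i) (h.locL2 p) (h.grad_locL2 p i) (h.periodic p).aePeriodic k

theorem IsW12Per.memLp (h : IsW12Per b v G) (p i : Fin n) :
    MemLp (fun x => G x p i) 2 (cellMeasure b) := (h.grad_locL2 p i).memLp_cell

theorem IsW12Per.integral_grad (h : IsW12Per b v G) (p i : Fin n) :
    ∫ x, G x p i ∂cellMeasure b = 0 := by
  have e := h.coeff_grad p i 0
  rw [coeff_zero (fun x => G x p i), freq_zero] at e
  simpa using e

/-- Minors of periodic gradients are null Lagrangians. -/
theorem IsW12Per.integral_mul_comm (h : IsW12Per b v G) (h' : IsW12Per b w G') (p i q j : Fin n) :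
    ∫ x, G x p i * G' x q j ∂cellMeasure b = ∫ x, G x p j * G' x q i ∂cellMeasure b := by
  have h1 := hasSum_coeff_real (h.memLp p i) (h'.memLp q j)
  have h2 := hasSum_coeff_real (h.memLp p j) (h'.memLp q i)
  have e := h1.unique (h2.congr_fun fun k => ?_)
  · exact_mod_cast e
  · simp only [h.coeff_grad, h'.coeff_grad, map_mul, Complex.conj_ofReal, Complex.conj_I]
    ring

theorem LocL2.congr {f g : EuclideanSpace ℝ (Fin n) → ℝ} (hf : LocL2 f) (h : f =ᵐ[volume] g) :
    LocL2 g := fun K hK => (memLp_congr_ae (ae_restrict_of_ae h)).1 (hf K hK)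

theorem LocL2.const_mul {f : EuclideanSpace ℝ (Fin n) → ℝ} (hf : LocL2 f) (c : ℝ) :
    LocL2 fun x => c * f x := fun K hK => (hf K hK).const_mul c

theorem LocL2.add {f g : EuclideanSpace ℝ (Fin n) → ℝ} (hf : LocL2 f) (hg : LocL2 g) :
    LocL2 fun x => f x + g x := fun K hK => (hf K hK).add (hg K hK)

theorem IsWeakPartial.const_mul {i : Fin n} {f g : EuclideanSpace ℝ (Fin n) → ℝ}
    (h : IsWeakPartial i f g) (c : ℝ) : IsWeakPartial i (fun x => c * f x) fun x => c * g x := by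
  intro φ hφ hc
  simp only [mul_assoc, integral_const_mul, h φ hφ hc, mul_neg]

theorem LocL2.integrable_mul {f φ : EuclideanSpace ℝ (Fin n) → ℝ} (hf : LocL2 f)
    (hφ : Continuous φ) (hc : HasCompactSupport φ) : Integrable fun x => f x * φ x := by
  have := (locallyIntegrable_of_compact hf).integrable_smul_left_of_hasCompactSupport hφ hc
  simpa only [smul_eq_mul, mul_comm] using this

theorem IsWeakPartial.add {i : Fin n} {f g f' g' : EuclideanSpace ℝ (Fin n) → ℝ}
    (h : IsWeakPartial i f g) (h' : IsWeakPartial i f' g') (hf : LocL2 f) (hg : LocL2 g)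
    (hf' : LocL2 f') (hg' : LocL2 g') :
    IsWeakPartial i (fun x => f x + f' x) fun x => g x + g' x := by
  intro φ hφ hc
  have hcd := fderiv_continuous_apply hφ (EuclideanSpace.single i 1)
  have hcc := hc.fderiv_apply ℝ (EuclideanSpace.single i 1)
  simp only [add_mul]
  rw [integral_add (hf.integrable_mul hcd hcc) (hf'.integrable_mul hcd hcc),
    integral_add (hg.integrable_mul hφ.continuous hc) (hg'.integrable_mul hφ.continuous hc),
    h φ hφ hc, h' φ hφ hc, neg_add]

theorem IsWeakPartial.congr {i : Fin n} {f g f' : EuclideanSpace ℝ (Fin n) → ℝ}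
    (h : IsWeakPartial i f g) (hf : f =ᵐ[volume] f') : IsWeakPartial i f' g := by
  intro φ hφ hc
  rw [← h φ hφ hc]
  refine integral_congr_ae ?_
  filter_upwards [hf] with x hx
  rw [hx]

theorem IsW12Per.add (h : IsW12Per b v G) (h' : IsW12Per b w G') :
    IsW12Per b (fun p x => v p x + w p x) (fun x => G x + G' x) where
  periodic p i x := by simp only [h.periodic p i x, h'.periodic p i x]
  locL2 p := (h.locL2 p).add (h'.locL2 p)
  grad_locL2 p i := (h.grad_locL2 p i).add (h'.grad_locL2 p i)
  grad p i := (h.grad p i).add (h'.grad p i) (h.locL2 p) (h.grad_locL2 p i) (h'.locL2 p)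
    (h'.grad_locL2 p i)

theorem IsW12Per.smul (h : IsW12Per b v G) (c : ℝ) :
    IsW12Per b (fun p x => c * v p x) (fun x => c • G x) where
  periodic p i x := by simp only [h.periodic p i x]
  locL2 p := (h.locL2 p).const_mul c
  grad_locL2 p i := (h.grad_locL2 p i).const_mul c
  grad p i := (h.grad p i).const_mul c

theorem locL2_zero : LocL2 (n := n) fun _ => (0 : ℝ) := fun _ _ => MemLp.zero

theorem isW12Per_zero : IsW12Per b (fun _ _ => (0 : ℝ)) (fun _ => 0) where
  periodic p i x := rfl
  locL2 p := locL2_zero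
  grad_locL2 p i := locL2_zero
  grad p i φ _ _ := by simp

end

/-! ### Periodic Hessians -/

section

variable {u : EuclideanSpace ℝ (Fin n) → ℝ} {g : Fin n → EuclideanSpace ℝ (Fin n) → ℝ}
  {H : EuclideanSpace ℝ (Fin n) → Matrix (Fin n) (Fin n) ℝ}

theorem IsW22Per.smul (h : IsW22Per b u g H) (c : ℝ) :
    IsW22Per b (fun x => c * u x) (fun i x => c * g i x) (fun x => c • H x) where
  periodic i x := by simp only [h.periodic i x]
  locL2 := h.locL2.const_mul c
  grad_locL2 i := (h.grad_locL2 i).const_mul c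
  grad i := (h.grad i).const_mul c
  hess_locL2 i j := (h.hess_locL2 i j).const_mul c
  hess i j := (h.hess i j).const_mul c

/-- Evaluating at the fractional part gives a function periodic at every point. This is needed
because the periodicity clause of `IsW12Per` is pointwise, while weak gradients are periodic only up
to null sets. -/
theorem exists_periodic_ae_eq {f : EuclideanSpace ℝ (Fin n) → ℝ} (hf : AEPeriodic b f) :
    ∃ f', IsPeriodic b f' ∧ f =ᵐ[volume] f' := by
  refine ⟨fun x => f (ZSpan.fract b x), fun i x => ?_, ?_⟩
  · simp only
    rw [ZSpan.fract_add_ZSpan b x (Submodule.subset_span ⟨i, rfl⟩)]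
  · have h : ∀ᵐ x, ∀ m, f (x + latticePoint b m) = f x := ae_all_iff.2 hf
    filter_upwards [h] with x hx
    rw [← hx fun i => -⌊b.repr x i⌋]
    congr 1
    rw [ZSpan.fract_apply, sub_eq_add_neg]
    congr 1
    simp [ZSpan.floor, latticePoint, Int.cast_smul_eq_zsmul]

/-- The gradient of a function in `W^{2,2}_per` is in `W^{1,2}_per`. -/
theorem IsW22Per.exists_isW12Per (h : IsW22Per b u g H) : ∃ v, IsW12Per b v H := by
  have hp : ∀ i, ∃ f', IsPeriodic b f' ∧ g i =ᵐ[volume] f' := fun i =>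
    exists_periodic_ae_eq ((h.grad i).aePeriodic h.periodic.aePeriodic (h.grad_locL2 i))
  choose v hv hgv using hp
  exact ⟨v, hv, fun p => (h.grad_locL2 p).congr (hgv p), h.hess_locL2,
    fun p i => (h.hess p i).congr (hgv p)⟩

/-- Both mixed derivatives have Fourier coefficients −ξᵢξⱼ times those of u. -/
theorem IsW22Per.hess_symm (h : IsW22Per b u g H) : ∀ᵐ x ∂cellMeasure b, (H x).IsSymm := by
  have key : ∀ i j, ∀ᵐ x ∂cellMeasure b, H x j i = H x i j := by
    intro i j
    have e : ∀ i j k, coeff b (fun x => (H x i j : ℂ)) k = Complex.I * freq b k j *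
        (Complex.I * freq b k i * coeff b (fun x => (u x : ℂ)) k) := by
      intro i j k
      have hp := (h.grad i).aePeriodic h.periodic.aePeriodic (h.grad_locL2 i)
      rw [coeff_weakPartial (h.hess i j) (h.grad_locL2 i) (h.hess_locL2 i j) hp,
        coeff_weakPartial (h.grad i) h.locL2 (h.grad_locL2 i) h.periodic.aePeriodic]
    have := ae_eq_of_coeff_eq b (f := fun x => (H x j i : ℂ)) (g := fun x => (H x i j : ℂ))
      (h.hess_locL2 j i).memLp_cell.ofReal (h.hess_locL2 i j).memLp_cell.ofReal
      (fun k => by rw [e, e]; ring)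
    filter_upwards [this] with x hx
    exact_mod_cast hx
  have := ae_all_iff.2 fun i => ae_all_iff.2 fun j => key i j
  filter_upwards [this] with x hx
  exact Matrix.IsSymm.ext fun i j => hx i j

end

/-! ### Fourier multipliers and the periodic Poisson equation -/

theorem PerL2.re {f : EuclideanSpace ℝ (Fin n) → ℂ} (hf : PerL2 b f) : LocL2 fun x => (f x).re :=
  fun K hK => (hf.memLp K hK).re

/-- Test functions are real, so real parts may be taken in the complex identity. Multiplier
solutions then need no check that their coefficients are conjugate-symmetric. -/
theorem isWeakPartial_re_of_coeff {i : Fin n} {f g : EuclideanSpace ℝ (Fin n) → ℂ}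
    (hf : PerL2 b f) (hg : PerL2 b g)
    (h : ∀ k, coeff b g k = Complex.I * freq b k i * coeff b f k) :
    IsWeakPartial i (fun x => (f x).re) (fun x => (g x).re) := by
  intro φ hφ hc
  have hφ' : ContDiff ℝ ∞ fun x => (φ x : ℂ) := Complex.ofRealCLM.contDiff.comp hφ
  have hc' : HasCompactSupport fun x => (φ x : ℂ) := hc.comp_left Complex.ofReal_zero
  have e := integral_mul_fderiv_of_coeff hf hg h hφ' hc'
  have hd : ∀ x, fderiv ℝ (fun x => (φ x : ℂ)) x (EuclideanSpace.single i 1) =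
      ((fderiv ℝ φ x (EuclideanSpace.single i 1) : ℝ) : ℂ) := by
    intro x
    have : HasFDerivAt (fun x => (φ x : ℂ)) (Complex.ofRealCLM.comp (fderiv ℝ φ x)) x :=
      Complex.ofRealCLM.hasFDerivAt.comp x
        (hφ.differentiable (by simp)).differentiableAt.hasFDerivAt
    rw [this.fderiv]; rfl
  have hi1 : Integrable fun x => f x * fderiv ℝ (fun x => (φ x : ℂ)) x (EuclideanSpace.single i 1) :=
    integrable_mul_of_box (locallyIntegrable_of_compact hf.memLp) (fderiv_continuous_apply hφ' _)
      (hc'.fderiv_apply ℝ _)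
  have hi2 : Integrable fun x => g x * (φ x : ℂ) :=
    integrable_mul_of_box (locallyIntegrable_of_compact hg.memLp) hφ'.continuous hc'
  have e' := congrArg Complex.reCLM e
  rw [map_neg, ← Complex.reCLM.integral_comp_comm hi1, ← Complex.reCLM.integral_comp_comm hi2] at e'
  simpa [hd] using e'

theorem phase_basis (k : Fin n → ℤ) (j : Fin n) : phase b k (b j) = 2 * Real.pi * k j := by
  rw [phase_apply, Finset.sum_eq_single j]
  · simp
  · intro i _ hi
    simp [hi.symm]
  · simp

theorem phase_eq_sum_freq (k : Fin n → ℤ) (x : EuclideanSpace ℝ (Fin n)) :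
    phase b k x = ∑ i, freq b k i * x i := by
  have hx : x = ∑ i, x i • EuclideanSpace.single i (1 : ℝ) := by
    ext j
    simp [Finset.sum_apply, Pi.single_apply]
  conv_lhs => rw [hx]
  rw [map_sum]
  simp only [map_smul, smul_eq_mul, freq, mul_comm]

/-- Nonzero dual lattice vectors are bounded away from zero. -/
theorem exists_freq_bound (b : Module.Basis (Fin n) ℝ (EuclideanSpace ℝ (Fin n))) :
    ∃ B : ℝ, 0 ≤ B ∧ ∀ k : Fin n → ℤ, k ≠ 0 →
      0 < ∑ i, freq b k i ^ 2 ∧ 1 ≤ B * ∑ i, freq b k i ^ 2 := by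
  -- For the frequency vector ξ of k, ξ·bⱼ = 2πkⱼ; if kⱼ ≠ 0, Cauchy–Schwarz gives 1 ≤ |ξ|²|bⱼ|²,
  -- and summing over all basis vectors makes the constant independent of j.
  refine ⟨∑ j, ∑ i, (b j) i ^ 2, by positivity, fun k hk => ?_⟩
  obtain ⟨j, hj⟩ := Function.ne_iff.1 hk
  have h1 : (1 : ℝ) ≤ (k j : ℝ) ^ 2 := by
    have : (1 : ℤ) ≤ k j ^ 2 := by
      have := sq_pos_of_ne_zero hj
      omega
    exact_mod_cast this
  have h2 : (1 : ℝ) ≤ (2 * Real.pi * k j) ^ 2 := by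
    have := Real.pi_gt_three
    rw [mul_pow]
    nlinarith [sq_nonneg (2 * Real.pi)]
  have h3 : (2 * Real.pi * k j) ^ 2 ≤ (∑ i, freq b k i ^ 2) * ∑ i, (b j) i ^ 2 := by
    rw [← phase_basis (b := b), phase_eq_sum_freq]
    exact Finset.sum_mul_sq_le_sq_mul_sq _ _ _
  have h4 : ∑ i, (b j) i ^ 2 ≤ ∑ j, ∑ i, (b j) i ^ 2 :=
    Finset.single_le_sum (f := fun j => ∑ i, (b j) i ^ 2) (fun j _ => by positivity)
      (Finset.mem_univ j)
  have h5 : 0 ≤ ∑ i, freq b k i ^ 2 := by positivity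
  have h6 := mul_le_mul_of_nonneg_left h4 h5
  have h7 : 1 ≤ (∑ j, ∑ i, (b j) i ^ 2) * ∑ i, freq b k i ^ 2 := by linarith
  refine ⟨h5.lt_of_ne fun h0 => ?_, h7⟩
  rw [← h0, mul_zero] at h7
  linarith

/-- A bounded multiplier preserves square summability, so Riesz–Fischer supplies the function. -/
theorem exists_multiplier {w : EuclideanSpace ℝ (Fin n) → ℝ} (hw : MemLp w 2 (cellMeasure b))
    (m : (Fin n → ℤ) → ℂ) {C : ℝ} (hm : ∀ k, ‖m k‖ ^ 2 ≤ C) :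
    ∃ f : EuclideanSpace ℝ (Fin n) → ℂ, PerL2 b f ∧
      (∀ x m, f (x + latticePoint b m) = f x) ∧
      ∀ k, coeff b f k = m k * coeff b (fun x => (w x : ℂ)) k := by
  have hs : Summable fun k => ‖coeff b (fun x => (w x : ℂ)) k‖ ^ 2 := by
    have h := (hasSum_coeff_real hw hw).summable.norm
    refine h.congr fun k => ?_
    rw [norm_mul, RCLike.norm_conj, sq]
  obtain ⟨f, hfm, hfp, hfL, hfc⟩ := exists_coeff_eq b
    (c := fun k => m k * coeff b (fun x => (w x : ℂ)) k)
    ((hs.mul_left C).of_nonneg_of_le (fun k => by positivity) fun k => by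
      rw [norm_mul, mul_pow]
      exact mul_le_mul_of_nonneg_right (hm k) (by positivity))
  exact ⟨f, PerL2.of_memLp hfm hfp hfL, hfp, hfc⟩

/-- The periodic Poisson equation `Δu = w`, for `w` of mean zero. -/
theorem exists_poisson {w : EuclideanSpace ℝ (Fin n) → ℝ} (hw : MemLp w 2 (cellMeasure b))
    (h0 : ∫ x, w x ∂cellMeasure b = 0) :
    ∃ u g H, IsW22Per b u g H ∧ ∀ᵐ x ∂cellMeasure b, (H x).trace = w x := by
  obtain ⟨B, hB0, hB⟩ := exists_freq_bound b
  set s : (Fin n → ℤ) → ℝ := fun k => ∑ i, freq b k i ^ 2 with hs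
  have hs0 : s 0 = 0 := by simp [hs, freq_zero]
  have hfs : ∀ k i, freq b k i ^ 2 ≤ s k := fun k i =>
    Finset.single_le_sum (f := fun i => freq b k i ^ 2) (fun i _ => sq_nonneg _)
      (Finset.mem_univ i)
  -- With 0⁻¹ = 0 the symbols are defined at k = 0 as well, and the bounds hold there trivially.
  have hinv : ∀ k, 0 ≤ (s k)⁻¹ ∧ (s k)⁻¹ ≤ B := by
    intro k
    rcases eq_or_ne k 0 with rfl | hk
    · rw [hs0]; simpa using hB0
    · have := hB k hk
      exact ⟨by have := this.1; positivity, by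
        rw [inv_le_iff_one_le_mul₀ this.1]; exact this.2⟩
  have hsi : ∀ k, s k * (s k)⁻¹ ≤ 1 := fun k => mul_inv_le_one
  have hs0' : ∀ k, 0 ≤ s k := fun k => by positivity
  obtain ⟨U, hU, hUp, hUc⟩ := exists_multiplier hw (fun k => ((-(s k)⁻¹ : ℝ) : ℂ)) (C := B ^ 2)
    (fun k => by
      rw [Complex.norm_real, Real.norm_eq_abs, sq_abs, neg_sq]
      exact pow_le_pow_left₀ (hinv k).1 (hinv k).2 2)
  have hg := fun i => exists_multiplier hw
    (fun k => Complex.I * ((freq b k i * -(s k)⁻¹ : ℝ) : ℂ)) (C := B) (fun k => by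
      rw [norm_mul, Complex.norm_I, one_mul, Complex.norm_real, Real.norm_eq_abs, sq_abs, mul_pow,
        neg_sq]
      calc freq b k i ^ 2 * (s k)⁻¹ ^ 2 ≤ s k * (s k)⁻¹ ^ 2 :=
            mul_le_mul_of_nonneg_right (hfs k i) (by positivity)
        _ = (s k * (s k)⁻¹) * (s k)⁻¹ := by ring
        _ ≤ 1 * (s k)⁻¹ := mul_le_mul_of_nonneg_right (hsi k) (hinv k).1
        _ ≤ B := by rw [one_mul]; exact (hinv k).2)
  choose g hgL hgp hgc using hg
  have hH := fun i j => exists_multiplier hw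
    (fun k => ((freq b k i * freq b k j * (s k)⁻¹ : ℝ) : ℂ)) (C := 1) (fun k => by
      rw [Complex.norm_real, Real.norm_eq_abs, sq_abs]
      calc (freq b k i * freq b k j * (s k)⁻¹) ^ 2
          = freq b k i ^ 2 * freq b k j ^ 2 * (s k)⁻¹ ^ 2 := by ring
        _ ≤ s k * s k * (s k)⁻¹ ^ 2 := by
            refine mul_le_mul_of_nonneg_right ?_ (by positivity)
            exact mul_le_mul (hfs k i) (hfs k j) (sq_nonneg _) (hs0' k)
        _ = (s k * (s k)⁻¹) ^ 2 := by ring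
        _ ≤ 1 := pow_le_one₀ (mul_nonneg (hs0' k) (hinv k).1) (hsi k))
  choose H hHL hHp hHc using hH
  refine ⟨fun x => (U x).re, fun i x => (g i x).re, fun x => Matrix.of fun i j => (H i j x).re,
    ⟨?_, hU.re, fun i => (hgL i).re, fun i => isWeakPartial_re_of_coeff hU (hgL i) fun k => ?_,
      fun i j => (hHL i j).re, fun i j => isWeakPartial_re_of_coeff (hgL i) (hHL i j) fun k => ?_⟩,
      ?_⟩
  · intro i x
    have : b i = latticePoint b (Pi.single i 1) := by
      simp [latticePoint, Pi.single_apply]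
    simp only
    rw [this, hUp]
  · rw [hgc, hUc]; push_cast; ring
  · rw [hHc, hgc]; push_cast
    linear_combination ((freq b k i * freq b k j * (s k : ℂ)⁻¹ *
      coeff b (fun x => (w x : ℂ)) k)) * Complex.I_mul_I
  · have hsumL : MemLp (fun x => ∑ i, H i i x) 2 (cellMeasure b) :=
      memLp_finsetSum _ fun i _ => (hHL i i).memLp_cell
    have hci : ∀ i k, Integrable (fun x => conj (latticeChar b k x) * H i i x) (cellMeasure b) := by
      intro i k
      refine ((hHL i i).memLp_cell.integrable (by norm_num)).bdd_mul (c := 1)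
        (Complex.continuous_conj.comp (continuous_latticeChar b k)).aestronglyMeasurable
        (ae_of_all _ fun x => ?_)
      rw [RCLike.norm_conj, norm_latticeChar]
    have hae := ae_eq_of_coeff_eq b (f := fun x => ∑ i, H i i x) (g := fun x => (w x : ℂ)) hsumL
      hw.ofReal (fun k => by
        have e1 : coeff b (fun x => ∑ i, H i i x) k = ∑ i, coeff b (H i i) k := by
          simp only [coeff, Finset.mul_sum]
          rw [integral_finsetSum _ fun i _ => hci i k]
        rw [e1]
        simp only [hHc]
        rw [← Finset.sum_mul]
        rcases eq_or_ne k 0 with rfl | hk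
        -- The zero mode, which the multiplier discards, is the mean of w.
        · rw [coeff_zero, h0]; simp
        · have h1 : ∑ i, ((freq b k i * freq b k i * (s k)⁻¹ : ℝ) : ℂ) = 1 := by
            rw [← Complex.ofReal_sum, ← Finset.sum_mul]
            have : ∑ i, freq b k i * freq b k i = s k := by simp only [hs, sq]
            rw [this, mul_inv_cancel₀ (hB k hk).1.ne', Complex.ofReal_one]
          rw [h1, one_mul])
    filter_upwards [hae] with x hx
    have := congrArg Complex.re hx
    simpa [Matrix.trace] using this

end Sobolev

/-! ### Algebra of tensors -/

section Algebra

variable {n : ℕ}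

theorem frob_add_left (F G H : Matrix (Fin n) (Fin n) ℝ) : frob (F + G) H = frob F H + frob G H := by
  simp [frob, add_mul, Finset.sum_add_distrib]

theorem frob_comm (F G : Matrix (Fin n) (Fin n) ℝ) : frob F G = frob G F := by
  simp [frob, mul_comm]

theorem frob_add_right (F G H : Matrix (Fin n) (Fin n) ℝ) :
    frob F (G + H) = frob F G + frob F H := by
  rw [frob_comm, frob_add_left, frob_comm G, frob_comm H]

theorem frob_smul_left (c : ℝ) (F G : Matrix (Fin n) (Fin n) ℝ) :
    frob (c • F) G = c * frob F G := by
  simp [frob, mul_assoc, Finset.mul_sum]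

theorem frob_smul_right (c : ℝ) (F G : Matrix (Fin n) (Fin n) ℝ) :
    frob F (c • G) = c * frob F G := by
  rw [frob_comm, frob_smul_left, frob_comm]

theorem frob_neg_left (F G : Matrix (Fin n) (Fin n) ℝ) : frob (-F) G = -frob F G := by
  simp [frob]

theorem frob_neg_right (F G : Matrix (Fin n) (Fin n) ℝ) : frob F (-G) = -frob F G := by
  simp [frob]

theorem frob_sub_left (F G H : Matrix (Fin n) (Fin n) ℝ) :
    frob (F - G) H = frob F H - frob G H := by
  rw [sub_eq_add_neg, frob_add_left, frob_neg_left, ← sub_eq_add_neg]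

theorem frob_sub_right (F G H : Matrix (Fin n) (Fin n) ℝ) :
    frob F (G - H) = frob F G - frob F H := by
  rw [sub_eq_add_neg, frob_add_right, frob_neg_right, ← sub_eq_add_neg]

theorem frob_zero_right (F : Matrix (Fin n) (Fin n) ℝ) : frob F 0 = 0 := by simp [frob]

theorem frob_one_right (F : Matrix (Fin n) (Fin n) ℝ) : frob F 1 = F.trace := by
  simp [frob, Matrix.one_apply, Matrix.trace]

theorem frob_transpose (F G : Matrix (Fin n) (Fin n) ℝ) : frob Fᵀ Gᵀ = frob F G := by
  simp only [frob, transpose_apply]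
  exact Finset.sum_comm

theorem frob_self_nonneg (F : Matrix (Fin n) (Fin n) ℝ) : 0 ≤ frob F F :=
  Finset.sum_nonneg fun _ _ => Finset.sum_nonneg fun _ _ => mul_self_nonneg _

theorem eq_zero_of_frob_self {F : Matrix (Fin n) (Fin n) ℝ} (h : frob F F = 0) : F = 0 := by
  ext p i
  have h1 := (Finset.sum_eq_zero_iff_of_nonneg fun p _ =>
    Finset.sum_nonneg fun i _ => mul_self_nonneg (F p i)).1 h p (Finset.mem_univ p)
  exact mul_self_eq_zero.1
    ((Finset.sum_eq_zero_iff_of_nonneg fun i _ => mul_self_nonneg (F p i)).1 h1 i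
      (Finset.mem_univ i))

theorem frob_transpose_le (F : Matrix (Fin n) (Fin n) ℝ) : frob F Fᵀ ≤ frob F F := by
  have h := frob_self_nonneg (F - Fᵀ)
  rw [frob_sub_left, frob_sub_right, frob_sub_right, frob_transpose, frob_comm Fᵀ F] at h
  linarith

theorem frob_single (F : Matrix (Fin n) (Fin n) ℝ) (p i : Fin n) :
    frob (Matrix.single p i 1) F = F p i := by
  rw [frob, Finset.sum_eq_single p]
  · rw [Finset.sum_eq_single i]
    · simp
    · intro j _ hj; simp [hj.symm]
    · simp
  · intro q _ hq; simp [hq.symm]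
  · simp

theorem Tensor.ext_frob {F G : Matrix (Fin n) (Fin n) ℝ} (h : ∀ A, frob A F = frob A G) : F = G := by
  ext p i
  have := h (Matrix.single p i 1)
  rwa [frob_single, frob_single] at this

theorem Tensor.IsSymmetric.frob_apply_comm {T : Tensor n} (hT : T.IsSymmetric)
    (F G : Matrix (Fin n) (Fin n) ℝ) : frob F (T G) = frob G (T F) := by
  rw [hT F G, frob_comm]

theorem Tensor.IsSymmetric.frob_add {T : Tensor n} (hT : T.IsSymmetric)
    (F G : Matrix (Fin n) (Fin n) ℝ) :
    frob (F + G) (T (F + G)) = frob F (T F) + 2 * frob F (T G) + frob G (T G) := by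
  rw [map_add, frob_add_left, frob_add_right, frob_add_right, hT.frob_apply_comm G F]
  ring

theorem Tensor.IsSymmetric.frob_sub {T : Tensor n} (hT : T.IsSymmetric)
    (F G : Matrix (Fin n) (Fin n) ℝ) :
    frob (F - G) (T (F - G)) = frob F (T F) - 2 * frob F (T G) + frob G (T G) := by
  rw [map_sub, frob_sub_left, frob_sub_right, frob_sub_right, hT.frob_apply_comm G F]
  ring

theorem Tensor.IsSymmetric.eq_of_frob {S T : Tensor n} (hS : S.IsSymmetric) (hT : T.IsSymmetric)
    (h : ∀ F, frob F (S F) = frob F (T F)) : S = T := by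
  refine LinearMap.ext fun F => Tensor.ext_frob fun A => ?_
  have h1 := hS.frob_add A F
  have h2 := hT.frob_add A F
  rw [h, h A, h F] at h1
  linarith

/-- The Cauchy–Schwarz inequality for a positive semi-definite tensor. -/
theorem Tensor.IsSymmetric.sq_frob_le {T : Tensor n} (hT : T.IsSymmetric)
    (hpos : ∀ F, 0 ≤ frob F (T F)) (F G : Matrix (Fin n) (Fin n) ℝ) :
    frob F (T G) ^ 2 ≤ frob F (T F) * frob G (T G) := by
  have h : ∀ s : ℝ, 0 ≤ frob F (T F) * (s * s) + 2 * frob F (T G) * s + frob G (T G) := by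
    intro s
    have := hpos (s • F + G)
    rw [hT.frob_add, map_smul, frob_smul_left, frob_smul_left, frob_smul_right] at this
    linarith
  have := discrim_le_zero h
  rw [discrim] at this
  linarith

/-- Cauchy–Schwarz, with T F itself as the other argument. -/
theorem Tensor.IsSymmetric.apply_eq_zero {T : Tensor n} (hT : T.IsSymmetric)
    (hpos : ∀ F, 0 ≤ frob F (T F)) {F : Matrix (Fin n) (Fin n) ℝ} (h : frob F (T F) = 0) :
    T F = 0 := by
  have := hT.sq_frob_le hpos (T F) F
  rw [h, mul_zero] at this
  exact eq_zero_of_frob_self ((pow_eq_zero_iff two_ne_zero).1 (le_antisymm this (sq_nonneg _)))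

theorem Tensor.IsSymmetric.sub {S T : Tensor n} (hS : S.IsSymmetric) (hT : T.IsSymmetric) :
    (S - T).IsSymmetric := fun F G => by
  rw [LinearMap.sub_apply, LinearMap.sub_apply, frob_sub_left, frob_sub_right, hS, hT]

theorem Tensor.IsSymmetric.neg {T : Tensor n} (hT : T.IsSymmetric) : (-T).IsSymmetric :=
  fun F G => by rw [LinearMap.neg_apply, LinearMap.neg_apply, frob_neg_left, frob_neg_right, hT]

theorem Tensor.apply_eq_sum (T : Tensor n) (F : Matrix (Fin n) (Fin n) ℝ) (p i : Fin n) :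
    (T F) p i = ∑ q, ∑ j, F q j * T (Matrix.single q j 1) p i := by
  conv_lhs => rw [Matrix.matrix_eq_sum_single F]
  simp only [map_sum, Matrix.sum_apply]
  refine Finset.sum_congr rfl fun q _ => Finset.sum_congr rfl fun j _ => ?_
  rw [show Matrix.single q j (F q j) = F q j • Matrix.single q j (1 : ℝ) by simp, map_smul]
  rfl

theorem Tensor.exists_bound (T : Tensor n) : ∃ C, 0 ≤ C ∧ ∀ F, frob F (T F) ≤ C * frob F F := by
  refine ⟨∑ p, ∑ i, ∑ q, ∑ j, |T (Matrix.single q j 1) p i|, by positivity, fun F => ?_⟩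
  have hF := T.apply_eq_sum F
  have hle : ∀ p i, F p i ^ 2 ≤ frob F F := by
    intro p i
    have h1 : F p i * F p i ≤ ∑ i, F p i * F p i :=
      Finset.single_le_sum (f := fun i => F p i * F p i) (fun i _ => mul_self_nonneg _)
        (Finset.mem_univ i)
    have h2 : ∑ i, F p i * F p i ≤ frob F F :=
      Finset.single_le_sum (f := fun p => ∑ i, F p i * F p i)
        (fun p _ => Finset.sum_nonneg fun i _ => mul_self_nonneg _) (Finset.mem_univ p)
    rw [sq]; exact h1.trans h2
  have hFF : frob F (T F) = ∑ p, ∑ i, ∑ q, ∑ j, F p i * (F q j * T (Matrix.single q j 1) p i) := by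
    simp only [frob, hF, Finset.mul_sum]
  rw [hFF]
  simp only [Finset.sum_mul]
  refine Finset.sum_le_sum fun p _ => Finset.sum_le_sum fun i _ => Finset.sum_le_sum fun q _ =>
    Finset.sum_le_sum fun j _ => ?_
  have h1 : |F p i * F q j| ≤ frob F F := by
    rw [abs_le]
    constructor <;> nlinarith [hle p i, hle q j, sq_nonneg (F p i + F q j),
      sq_nonneg (F p i - F q j)]
  calc F p i * (F q j * T (Matrix.single q j 1) p i)
      = (F p i * F q j) * T (Matrix.single q j 1) p i := by ring
    _ ≤ |(F p i * F q j) * T (Matrix.single q j 1) p i| := le_abs_self _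
    _ = |F p i * F q j| * |T (Matrix.single q j 1) p i| := abs_mul _ _
    _ ≤ frob F F * |T (Matrix.single q j 1) p i| :=
        mul_le_mul_of_nonneg_right h1 (abs_nonneg _)
    _ = _ := mul_comm _ _

theorem frob_isoTensor (μ₁ μ₂ lam : ℝ) (F G : Matrix (Fin n) (Fin n) ℝ) :
    frob F (isoTensor n μ₁ μ₂ lam G) =
      μ₁ * frob F G + μ₂ * frob F Gᵀ + lam * (F.trace * G.trace) := by
  change frob F (μ₁ • G + μ₂ • Gᵀ + (lam * G.trace) • (1 : Matrix (Fin n) (Fin n) ℝ)) = _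
  rw [frob_add_right, frob_add_right, frob_smul_right, frob_smul_right, frob_smul_right,
    frob_one_right]
  ring

/-- An elasticity tensor sees only the symmetric part of its argument, where it is positive. -/
theorem Tensor.Admissible.nonneg {T : Tensor n} (hT : T.Admissible)
    (F : Matrix (Fin n) (Fin n) ℝ) : 0 ≤ frob F (T F) := by
  have h0 : frob (0 : Matrix (Fin n) (Fin n) ℝ) (T 0) = 0 := by rw [map_zero, frob_zero_right]
  rcases hT.2 with h | ⟨h1, h2, h3⟩
  · rcases eq_or_ne F 0 with rfl | hF
    · exact h0.ge
    · exact (h F hF).le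
  · have e1 : T ((1 / 2 : ℝ) • (F + Fᵀ)) = T F := by
      rw [map_smul, map_add, h2, ← two_smul ℝ (T F), smul_smul]; norm_num
    have e2 : frob ((1 / 2 : ℝ) • (F + Fᵀ)) (T F) = frob F (T F) := by
      have : frob Fᵀ (T F) = frob F (T F) := by
        rw [← frob_transpose, transpose_transpose, (h1 F).eq]
      rw [frob_smul_left, frob_add_left, this]; ring
    rw [← e2]
    conv_rhs => rw [← e1]
    rcases eq_or_ne ((1 / 2 : ℝ) • (F + Fᵀ)) 0 with h | h
    · rw [h]; exact h0.ge
    · exact (h3 _ (by rw [IsSymm, transpose_smul, transpose_add, transpose_transpose, add_comm]) h).le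

theorem Tensor.Admissible.pos_of_isSymm {T : Tensor n} (hT : T.Admissible)
    {F : Matrix (Fin n) (Fin n) ℝ} (hF : F.IsSymm) (h0 : F ≠ 0) : 0 < frob F (T F) := by
  rcases hT.2 with h | h
  · exact h F h0
  · exact h.2.2 F hF h0

theorem isoTensor_kappa_pos {μ₁ μ₂ lam : ℝ} (h : (isoTensor n μ₁ μ₂ lam).Admissible)
    (p : Fin n) : 0 < μ₁ + μ₂ + lam := by
  have hs : (Matrix.single p p (1 : ℝ)).IsSymm := by rw [IsSymm, transpose_single]
  have h1 := h.pos_of_isSymm hs (fun h => by simpa using congrFun (congrFun h p) p)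
  rw [frob_isoTensor, transpose_single, frob_single] at h1
  simp at h1
  linarith

/-- The symmetric combination of two off-diagonal units gives μ₁ + μ₂ > 0, the antisymmetric one μ₁
− μ₂ ≥ 0. -/
theorem isoTensor_mu_pos {μ₁ μ₂ lam : ℝ} (h : (isoTensor n μ₁ μ₂ lam).Admissible)
    {p q : Fin n} (hpq : p ≠ q) : 0 < μ₁ := by
  have hs : (Matrix.single p q (1 : ℝ) + Matrix.single q p 1).IsSymm := by
    rw [IsSymm, transpose_add, transpose_single, transpose_single, add_comm]
  have h1 := h.pos_of_isSymm hs (fun h => by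
    have := congrFun (congrFun h p) q
    simp [hpq, hpq.symm] at this)
  have h2 := h.nonneg (Matrix.single p q 1 - Matrix.single q p 1)
  rw [frob_isoTensor, transpose_add, transpose_single, transpose_single, frob_add_left,
    frob_add_left, frob_single, frob_single, frob_single, frob_single] at h1
  rw [frob_isoTensor, transpose_sub, transpose_single, transpose_single, frob_sub_left,
    frob_sub_left, frob_single, frob_single, frob_single, frob_single] at h2
  simp [hpq, hpq.symm] at h1 h2
  linarith

/-- The isotropic tensor can be written with a positive first coefficient, with the same sum of
the coefficients. -/
theorem exists_isoTensor_eq {μ₁ μ₂ lam : ℝ} (h : (isoTensor n μ₁ μ₂ lam).Admissible)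
    (p : Fin n) :
    ∃ μ₁' μ₂' lam', 0 < μ₁' ∧ isoTensor n μ₁' μ₂' lam' = isoTensor n μ₁ μ₂ lam ∧
      μ₁' + μ₂' + lam' = μ₁ + μ₂ + lam := by
  -- In dimension one the tensor is multiplication by the sum of the coefficients and μ₁ alone may
  -- have any sign, so the whole sum is moved into the first coefficient.
  rcases subsingleton_or_nontrivial (Fin n) with hs | hn
  · refine ⟨μ₁ + μ₂ + lam, 0, 0, isoTensor_kappa_pos h p, ?_, by ring⟩
    refine LinearMap.ext fun F => ?_
    ext i j
    obtain rfl := hs.elim j i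
    have ht : F.trace = F j j := by
      rw [Matrix.trace, Finset.sum_eq_single j (fun k _ hk => (hk (hs.elim k j)).elim) (by simp)]
      rfl
    simp [isoTensor, ht]
    ring
  · obtain ⟨p, q, hpq⟩ := exists_pair_ne (Fin n)
    exact ⟨μ₁, μ₂, lam, isoTensor_mu_pos h hpq, rfl, rfl⟩

end Algebra

/-! ### Partial minimization of quadratic forms -/

/-- The infimum of a positive semi-definite quadratic form over the translates of a subspace is a
quadratic form. -/
theorem exists_isGLB_bilin {V : Type*} [AddCommGroup V] [Module ℝ V] (B : V →ₗ[ℝ] V →ₗ[ℝ] ℝ)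
    (hsymm : ∀ x y, B x y = B y x) (hpos : ∀ x, 0 ≤ B x x) (K : Submodule ℝ V) :
    ∃ B' : V →ₗ[ℝ] V →ₗ[ℝ] ℝ, (∀ x y, B' x y = B' y x) ∧
      ∀ x, IsGLB {e | ∃ k ∈ K, e = B (x + k) (x + k)} (B' x x) := by
  -- B itself serves as the possibly degenerate inner product. Its Hilbert completion permits
  -- orthogonal projection without any coercivity of B.
  let c : PreInnerProductSpace.Core ℝ V :=
    { inner := fun x y => B x y
      conj_inner_symm := fun x y => by simp [hsymm x y]
      re_inner_nonneg := fun x => hpos x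
      add_left := fun x y z => by simp
      smul_left := fun x y r => by simp }
  let : SeminormedAddCommGroup V := InnerProductSpace.Core.toSeminormedAddCommGroup (c := c)
  let : InnerProductSpace ℝ V := InnerProductSpace.ofCore c
  have hB : ∀ x y : V, inner ℝ x y = B x y := fun _ _ => rfl
  let ι : V →L[ℝ] UniformSpace.Completion V := UniformSpace.Completion.toComplL
  let K' : Submodule ℝ (UniformSpace.Completion V) := (K.map ι.toLinearMap).topologicalClosure
  have hK' : CompleteSpace K' := (Submodule.isClosed_topologicalClosure _).completeSpace_coe
  -- P projects onto the orthogonal complement of the closure of K. The infimum is ‖P x‖², visibly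
  -- quadratic in x, by Pythagoras and density of K in its closure.
  let P : V →ₗ[ℝ] UniformSpace.Completion V :=
    (ContinuousLinearMap.id ℝ _ - K'.starProjection).toLinearMap ∘ₗ ι.toLinearMap
  refine ⟨LinearMap.mk₂ ℝ (fun x y => inner ℝ (P x) (P y)) (fun x y z => by rw [map_add, inner_add_left])
    (fun r x y => by rw [map_smul, real_inner_smul_left]; rfl)
    (fun x y z => by rw [map_add, inner_add_right])
    (fun r x y => by rw [map_smul, real_inner_smul_right]; rfl),
    fun x y => real_inner_comm (P y) (P x), fun x => ?_⟩
  have hι : ∀ x, B x x = ‖ι x‖ ^ 2 := fun x => by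
    rw [← hB, real_inner_self_eq_norm_sq]
    congr 1
    exact (UniformSpace.Completion.norm_coe x).symm
  have hP : ∀ x, P x = ι x - K'.starProjection (ι x) := fun x => rfl
  have hdec : ∀ k' ∈ K', ‖ι x + k'‖ ^ 2 = ‖P x‖ ^ 2 + ‖K'.starProjection (ι x) + k'‖ ^ 2 := by
    intro k' hk'
    have h1 : inner ℝ (P x) (K'.starProjection (ι x) + k') = 0 := by
      rw [hP]
      exact K'.starProjection_inner_eq_zero _ _ (K'.add_mem (K'.starProjection_apply_mem _) hk')
    have h2 : ι x + k' = P x + (K'.starProjection (ι x) + k') := by rw [hP]; abel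
    rw [h2, norm_add_sq_real, h1]
    ring
  have hxx : inner ℝ (P x) (P x) = ‖P x‖ ^ 2 := real_inner_self_eq_norm_sq _
  change IsGLB _ (inner ℝ (P x) (P x))
  rw [hxx]
  constructor
  · rintro _ ⟨k, hk, rfl⟩
    rw [hι, map_add, hdec (ι k) (Submodule.le_topologicalClosure _ (Submodule.mem_map_of_mem hk))]
    exact le_add_of_nonneg_right (by positivity)
  · intro a ha
    refine le_of_forall_pos_le_add fun ε hε => ?_
    have hmem : -K'.starProjection (ι x) ∈ closure ((K.map ι.toLinearMap : Submodule ℝ _) :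
        Set (UniformSpace.Completion V)) := K'.neg_mem (K'.starProjection_apply_mem _)
    obtain ⟨_, ⟨k, hk, rfl⟩, hd⟩ := Metric.mem_closure_iff.1 hmem (Real.sqrt ε) (Real.sqrt_pos.2 hε)
    have h1 := ha ⟨k, hk, rfl⟩
    rw [hι, map_add, hdec (ι k) (Submodule.le_topologicalClosure _ (Submodule.mem_map_of_mem hk))]
      at h1
    have h2 : ‖K'.starProjection (ι x) + ι k‖ ^ 2 ≤ ε := by
      have h3 : ‖K'.starProjection (ι x) + ι k‖ < Real.sqrt ε := by
        rw [dist_eq_norm] at hd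
        have : -K'.starProjection (ι x) - ι k = -(K'.starProjection (ι x) + ι k) := by abel
        rw [← norm_neg, ← this]
        exact hd
      calc _ ≤ Real.sqrt ε ^ 2 := pow_le_pow_left₀ (norm_nonneg _) h3.le 2
        _ = ε := Real.sq_sqrt hε.le
    linarith

/-! ### Square integrable matrix fields -/

section Fields

variable {n : ℕ}

variable {b : Module.Basis (Fin n) ℝ (EuclideanSpace ℝ (Fin n))}
  {G G' : EuclideanSpace ℝ (Fin n) → Matrix (Fin n) (Fin n) ℝ}

variable (b) in
/-- Matrix fields that are square integrable on the unit cell. -/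
def MatL2 (G : EuclideanSpace ℝ (Fin n) → Matrix (Fin n) (Fin n) ℝ) : Prop :=
  ∀ p i, MemLp (fun x => G x p i) 2 (cellMeasure b)

theorem MatL2.add (h : MatL2 b G) (h' : MatL2 b G') : MatL2 b fun x => G x + G' x :=
  fun p i => (h p i).add (h' p i)

theorem MatL2.sub (h : MatL2 b G) (h' : MatL2 b G') : MatL2 b fun x => G x - G' x :=
  fun p i => (h p i).sub (h' p i)

theorem MatL2.smul (h : MatL2 b G) (c : ℝ) : MatL2 b fun x => c • G x :=
  fun p i => (h p i).const_mul c

theorem matL2_const (F : Matrix (Fin n) (Fin n) ℝ) : MatL2 b fun _ => F :=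
  fun p i => memLp_const (F p i)

theorem MatL2.tensor (h : MatL2 b G) (T : Tensor n) : MatL2 b fun x => T (G x) := by
  intro p i
  rw [show (fun x => (T (G x)) p i) = _ from funext fun x => T.apply_eq_sum (G x) p i]
  exact memLp_finsetSum _ fun q _ => memLp_finsetSum _ fun j _ => (h q j).mul_const _

theorem MatL2.integrable_frob (h : MatL2 b G) (h' : MatL2 b G') :
    Integrable (fun x => frob (G x) (G' x)) (cellMeasure b) :=
  integrable_finsetSum _ fun p _ => integrable_finsetSum _ fun i _ =>
    (h p i).integrable_mul (h' p i)

theorem MatL2.memLp_trace (h : MatL2 b G) : MemLp (fun x => (G x).trace) 2 (cellMeasure b) :=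
  memLp_finsetSum _ fun p _ => h p p

theorem IsW12Per.matL2 {v : Fin n → EuclideanSpace ℝ (Fin n) → ℝ} (h : IsW12Per b v G) :
    MatL2 b G := h.memLp

/-! ### Phases -/

/-- The characteristic function. -/
noncomputable def phaseChar (Ω : Set (EuclideanSpace ℝ (Fin n))) (x : EuclideanSpace ℝ (Fin n)) :
    ℝ := Ω.indicator (fun _ => 1) x

variable {Ω : Set (EuclideanSpace ℝ (Fin n))}

theorem phaseChar_of_mem {x : EuclideanSpace ℝ (Fin n)} (h : x ∈ Ω) : phaseChar Ω x = 1 :=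
  Set.indicator_of_mem h _

theorem phaseChar_of_notMem {x : EuclideanSpace ℝ (Fin n)} (h : x ∉ Ω) : phaseChar Ω x = 0 :=
  Set.indicator_of_notMem h _

theorem phaseChar_mul_self (x : EuclideanSpace ℝ (Fin n)) :
    phaseChar Ω x * phaseChar Ω x = phaseChar Ω x := by
  by_cases h : x ∈ Ω
  · rw [phaseChar_of_mem h, one_mul]
  · rw [phaseChar_of_notMem h, zero_mul]

theorem phaseChar_nonneg (x : EuclideanSpace ℝ (Fin n)) : 0 ≤ phaseChar Ω x :=
  Set.indicator_nonneg (fun _ _ => zero_le_one) x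

theorem phaseChar_le_one (x : EuclideanSpace ℝ (Fin n)) : phaseChar Ω x ≤ 1 := by
  by_cases h : x ∈ Ω
  · rw [phaseChar_of_mem h]
  · rw [phaseChar_of_notMem h]; exact zero_le_one

theorem twoPhase_apply (L₁ L₀ : Tensor n) (x : EuclideanSpace ℝ (Fin n))
    (F : Matrix (Fin n) (Fin n) ℝ) :
    twoPhase L₁ L₀ Ω x F = L₀ F + phaseChar Ω x • (L₁ - L₀) F := by
  by_cases h : x ∈ Ω
  · simp [twoPhase, h, phaseChar_of_mem h]
  · simp [twoPhase, h, phaseChar_of_notMem h]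

theorem twoPhase_nonneg {L₁ L₀ : Tensor n} (h₀ : L₀.Admissible) (h₁ : L₁.Admissible)
    (x : EuclideanSpace ℝ (Fin n)) (F : Matrix (Fin n) (Fin n) ℝ) :
    0 ≤ frob F (twoPhase L₁ L₀ Ω x F) := by
  unfold twoPhase
  split_ifs
  · exact h₁.nonneg F
  · exact h₀.nonneg F

theorem twoPhase_symm {L₁ L₀ : Tensor n} (h₀ : L₀.IsSymmetric) (h₁ : L₁.IsSymmetric)
    (x : EuclideanSpace ℝ (Fin n)) : (twoPhase L₁ L₀ Ω x).IsSymmetric := by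
  unfold twoPhase
  split_ifs
  · exact h₁
  · exact h₀

theorem absolutelyContinuous_cellMeasure : cellMeasure b ≪ volume :=
  (Measure.smul_absolutelyContinuous).trans Measure.restrict_le_self.absolutelyContinuous

theorem aestronglyMeasurable_phaseChar (hΩ : NullMeasurableSet Ω volume) :
    AEStronglyMeasurable (phaseChar Ω) (cellMeasure b) :=
  (aestronglyMeasurable_const (b := (1 : ℝ))).indicator₀
    (hΩ.mono_ac absolutelyContinuous_cellMeasure)

theorem memLp_phaseChar (hΩ : NullMeasurableSet Ω volume) :
    MemLp (phaseChar Ω) 2 (cellMeasure b) :=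
  MemLp.of_bound (aestronglyMeasurable_phaseChar hΩ) 1 (ae_of_all _ fun x => by
    rw [Real.norm_eq_abs, abs_of_nonneg (phaseChar_nonneg x)]
    exact phaseChar_le_one x)

theorem integral_phaseChar (hΩ : NullMeasurableSet Ω volume) (hΩY : Ω ⊆ unitCell b) :
    ∫ x, phaseChar Ω x ∂cellMeasure b = volFrac b Ω := by
  unfold phaseChar
  rw [integral_indicator₀ (hΩ.mono_ac absolutelyContinuous_cellMeasure), setIntegral_const,
    smul_eq_mul, mul_one, Measure.real, cellMeasure, Measure.smul_apply, smul_eq_mul,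
    Measure.restrict_apply₀' (measurableSet_unitCell b).nullMeasurableSet,
    Set.inter_eq_left.2 hΩY, ENNReal.toReal_mul, ENNReal.toReal_inv, volFrac, Measure.real,
    Measure.real, div_eq_inv_mul]

theorem integrable_phaseChar_mul (hΩ : NullMeasurableSet Ω volume)
    {f : EuclideanSpace ℝ (Fin n) → ℝ} (hf : Integrable f (cellMeasure b)) :
    Integrable (fun x => phaseChar Ω x * f x) (cellMeasure b) :=
  hf.bdd_mul (c := 1) (aestronglyMeasurable_phaseChar hΩ) (ae_of_all _ fun x => by
    rw [Real.norm_eq_abs, abs_of_nonneg (phaseChar_nonneg x)]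
    exact phaseChar_le_one x)

theorem MatL2.twoPhase (hΩ : NullMeasurableSet Ω volume) (L₁ L₀ : Tensor n) (h : MatL2 b G) :
    MatL2 b fun x => twoPhase L₁ L₀ Ω x (G x) := by
  simp only [twoPhase_apply]
  refine (h.tensor L₀).add fun p i => ?_
  refine MemLp.of_le (h.tensor (L₁ - L₀) p i)
    ((aestronglyMeasurable_phaseChar hΩ).mul (h.tensor (L₁ - L₀) p i).1)
    (ae_of_all _ fun x => ?_)
  rw [Matrix.smul_apply, smul_eq_mul, norm_mul, Real.norm_eq_abs (phaseChar Ω x),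
    abs_of_nonneg (phaseChar_nonneg x)]
  exact mul_le_of_le_one_left (norm_nonneg _) (phaseChar_le_one x)

/-! ### Energies -/

variable (b) in
/-- Twice the energy of the gradient field `G` under the applied field `F`. -/
noncomputable def cellEnergy (L₁ L₀ : Tensor n) (Ω : Set (EuclideanSpace ℝ (Fin n)))
    (F : Matrix (Fin n) (Fin n) ℝ) (G : EuclideanSpace ℝ (Fin n) → Matrix (Fin n) (Fin n) ℝ) : ℝ :=
  ∫ x, frob (G x + F) (twoPhase L₁ L₀ Ω x (G x + F)) ∂cellMeasure b

theorem mem_energies_iff {L₁ L₀ : Tensor n} {F : Matrix (Fin n) (Fin n) ℝ} {e : ℝ} :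
    e ∈ energies b L₁ L₀ Ω F ↔ ∃ v G, IsW12Per b v G ∧ e = 1 / 2 * cellEnergy b L₁ L₀ Ω F G := by
  simp only [energies, average_unitCell, cellEnergy]
  rfl

/-- The effective tensor exists and is unique. -/
theorem existsUnique_isEffectiveTensor {L₁ L₀ : Tensor n} (h₀ : L₀.Admissible)
    (h₁ : L₁.Admissible) (hΩ : NullMeasurableSet Ω volume) :
    ∃! Le : Tensor n, IsEffectiveTensor b L₁ L₀ Ω Le := by
  let V : Submodule ℝ (EuclideanSpace ℝ (Fin n) → Matrix (Fin n) (Fin n) ℝ) :=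
    { carrier := {G | MatL2 b G}
      add_mem' := fun h h' => h.add h'
      zero_mem' := matL2_const 0
      smul_mem' := fun c G h => h.smul c }
  let K : Submodule ℝ V :=
    { carrier := {G | ∃ v, IsW12Per b v G.1}
      add_mem' := fun ⟨v, h⟩ ⟨w, h'⟩ => ⟨_, h.add h'⟩
      zero_mem' := ⟨_, isW12Per_zero⟩
      smul_mem' := fun c G ⟨v, h⟩ => ⟨_, h.smul c⟩ }
  have hint : ∀ G G' : V, Integrable (fun x => frob (G.1 x) (twoPhase L₁ L₀ Ω x (G'.1 x)))
      (cellMeasure b) := fun G G' => G.2.integrable_frob (G'.2.twoPhase hΩ L₁ L₀)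
  let B : V →ₗ[ℝ] V →ₗ[ℝ] ℝ := LinearMap.mk₂ ℝ
    (fun G G' => ∫ x, frob (G.1 x) (twoPhase L₁ L₀ Ω x (G'.1 x)) ∂cellMeasure b)
    (fun G₁ G₂ G' => by
      rw [← integral_add (hint G₁ G') (hint G₂ G')]
      simp only [← frob_add_left]; rfl)
    (fun c G G' => by
      rw [smul_eq_mul, ← integral_const_mul]
      simp only [← frob_smul_left]; rfl)
    (fun G G₁ G₂ => by
      rw [← integral_add (hint G G₁) (hint G G₂)]
      simp only [← frob_add_right, ← map_add]; rfl)
    (fun c G G' => by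
      rw [smul_eq_mul, ← integral_const_mul]
      simp only [← frob_smul_right, ← map_smul]; rfl)
  obtain ⟨B', hB', hglb⟩ := exists_isGLB_bilin B
    (fun G G' => integral_congr_ae (ae_of_all _ fun x =>
      (twoPhase_symm h₀.1 h₁.1 x).frob_apply_comm _ _))
    (fun G => integral_nonneg fun x => twoPhase_nonneg h₀ h₁ x _) K
  -- Applied fields are the constant fields; the effective tensor is the minimized form restricted
  -- to them.
  let cst : Matrix (Fin n) (Fin n) ℝ →ₗ[ℝ] V :=
    { toFun := fun F => ⟨fun _ => F, matL2_const F⟩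
      map_add' := fun F G => rfl
      map_smul' := fun c F => rfl }
  let Le : Tensor n :=
    { toFun := fun F => Matrix.of fun p i => B' (cst (Matrix.single p i 1)) (cst F)
      map_add' := fun F G => by ext p i; simp
      map_smul' := fun c F => by ext p i; simp }
  have hLe : ∀ A F, frob A (Le F) = B' (cst A) (cst F) := by
    intro A F
    conv_rhs => rw [Matrix.matrix_eq_sum_single A]
    simp only [map_sum, LinearMap.sum_apply]
    refine Finset.sum_congr rfl fun p _ => Finset.sum_congr rfl fun i _ => ?_
    rw [show Matrix.single p i (A p i) = A p i • Matrix.single p i (1 : ℝ) by simp, map_smul,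
      map_smul]
    rfl
  have hsymm : Le.IsSymmetric := fun A F => by rw [hLe, frob_comm, hLe, hB']
  have hLeff : IsEffectiveTensor b L₁ L₀ Ω Le := by
    refine ⟨hsymm, fun F => ?_⟩
    have h := hglb (cst F)
    rw [← hLe] at h
    have hE : ∀ G : V, B (cst F + G) (cst F + G) = cellEnergy b L₁ L₀ Ω F G.1 := by
      intro G
      have : ∀ x, (cst F + G).1 x = G.1 x + F := fun x => add_comm F (G.1 x)
      change ∫ x, frob ((cst F + G).1 x) (twoPhase L₁ L₀ Ω x ((cst F + G).1 x)) ∂cellMeasure b = _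
      simp only [this]
      rfl
    constructor
    · intro e he
      obtain ⟨v, G, hG, rfl⟩ := mem_energies_iff.1 he
      have := h.1 ⟨⟨G, hG.matL2⟩, ⟨v, hG⟩, rfl⟩
      rw [hE] at this
      linarith
    · intro a ha
      have : 2 * a ≤ frob F (Le F) := h.2 (by
        rintro _ ⟨G, ⟨v, hG⟩, rfl⟩
        rw [hE]
        have := ha (mem_energies_iff.2 ⟨v, G.1, hG, rfl⟩)
        linarith)
      linarith
  refine ⟨Le, hLeff, fun L' hL' => hL'.1.eq_of_frob hsymm fun F => ?_⟩
  have := (hL'.2 F).unique (hLeff.2 F)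
  linarith

end Fields

/-! ### The energy identity -/

section Identity

variable {n : ℕ} {b : Module.Basis (Fin n) ℝ (EuclideanSpace ℝ (Fin n))}
  {Ω : Set (EuclideanSpace ℝ (Fin n))}
  {G G' : EuclideanSpace ℝ (Fin n) → Matrix (Fin n) (Fin n) ℝ}
  {v w : Fin n → EuclideanSpace ℝ (Fin n) → ℝ}

theorem IsW12Per.integral_trace (h : IsW12Per b v G) :
    ∫ x, (G x).trace ∂cellMeasure b = 0 := by
  have : ∀ x, (G x).trace = ∑ p, G x p p := fun x => rfl
  simp only [this]
  rw [integral_finsetSum _ fun p _ => (h.memLp p p).integrable (by norm_num)]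
  simp [h.integral_grad]

theorem IsW12Per.integral_frob_const (h : IsW12Per b v G) (F : Matrix (Fin n) (Fin n) ℝ) :
    ∫ x, frob (G x) F ∂cellMeasure b = 0 := by
  have hi : ∀ p i, Integrable (fun x => G x p i * F p i) (cellMeasure b) := fun p i =>
    ((h.memLp p i).integrable (by norm_num)).mul_const _
  simp only [frob]
  rw [integral_finsetSum _ fun p _ => integrable_finsetSum _ fun i _ => hi p i]
  refine Finset.sum_eq_zero fun p _ => ?_
  rw [integral_finsetSum _ fun i _ => hi p i]
  refine Finset.sum_eq_zero fun i _ => ?_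
  rw [integral_mul_const, h.integral_grad, zero_mul]

/-- Sum the null Lagrangian identity over entries. It makes the μ₂ and λ terms of the isotropic
tensor interchangeable under the integral. -/
theorem IsW12Per.integral_frob_transpose (h : IsW12Per b v G) (h' : IsW12Per b w G') :
    ∫ x, frob (G x) (G' x)ᵀ ∂cellMeasure b = ∫ x, (G x).trace * (G' x).trace ∂cellMeasure b := by
  have hi : ∀ p i q j, Integrable (fun x => G x p i * G' x q j) (cellMeasure b) := fun p i q j =>
    (h.memLp p i).integrable_mul (h'.memLp q j)
  have e : ∀ x, (G x).trace * (G' x).trace = ∑ p, ∑ i, G x p p * G' x i i := fun x => by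
    simp only [Matrix.trace, Finset.sum_mul_sum, Matrix.diag]
  simp only [frob, e, transpose_apply]
  rw [integral_finsetSum _ fun p _ => integrable_finsetSum _ fun i _ => hi p i i p,
    integral_finsetSum _ fun p _ => integrable_finsetSum _ fun i _ => hi p p i i]
  refine Finset.sum_congr rfl fun p _ => ?_
  rw [integral_finsetSum _ fun i _ => hi p i i p, integral_finsetSum _ fun i _ => hi p p i i]
  exact Finset.sum_congr rfl fun i _ => h.integral_mul_comm h' p i i p

theorem IsW12Per.integral_trace_sq_le (h : IsW12Per b v G) :
    ∫ x, (G x).trace * (G x).trace ∂cellMeasure b ≤ ∫ x, frob (G x) (G x) ∂cellMeasure b := by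
  rw [← h.integral_frob_transpose h]
  refine integral_mono (h.matL2.integrable_frob fun p i => h.matL2 i p)
    (h.matL2.integrable_frob h.matL2) fun x => frob_transpose_le (G x)

theorem integral_frob_isoTensor (μ₁ μ₂ lam : ℝ) (h : IsW12Per b v G) (h' : IsW12Per b w G') :
    ∫ x, frob (G x) (isoTensor n μ₁ μ₂ lam (G' x)) ∂cellMeasure b =
      μ₁ * ∫ x, frob (G x) (G' x) ∂cellMeasure b +
        (μ₂ + lam) * ∫ x, (G x).trace * (G' x).trace ∂cellMeasure b := by
  simp only [frob_isoTensor]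
  have h1 := h.matL2.integrable_frob h'.matL2
  have h2 : Integrable (fun x => frob (G x) (G' x)ᵀ) (cellMeasure b) :=
    h.matL2.integrable_frob fun p i => h'.matL2 i p
  have h3 : Integrable (fun x => (G x).trace * (G' x).trace) (cellMeasure b) :=
    h.matL2.memLp_trace.integrable_mul h'.matL2.memLp_trace
  rw [integral_add ((h1.const_mul _).fun_add (h2.const_mul _)) (h3.const_mul _),
    integral_add (h1.const_mul _) (h2.const_mul _), integral_const_mul, integral_const_mul,
    integral_const_mul, h.integral_frob_transpose h']
  ring

/-- When the second field is symmetric the μ₁ term also becomes a product of traces, so only the sum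
of the three coefficients is left. -/
theorem integral_frob_isoTensor_of_isSymm (μ₁ μ₂ lam : ℝ) (h : IsW12Per b v G)
    (h' : IsW12Per b w G') (hs : ∀ᵐ x ∂cellMeasure b, (G' x).IsSymm) :
    ∫ x, frob (G x) (isoTensor n μ₁ μ₂ lam (G' x)) ∂cellMeasure b =
      (μ₁ + μ₂ + lam) * ∫ x, (G x).trace * (G' x).trace ∂cellMeasure b := by
  have e : ∫ x, frob (G x) (G' x) ∂cellMeasure b = ∫ x, (G x).trace * (G' x).trace ∂cellMeasure b := by
    rw [← h.integral_frob_transpose h']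
    refine integral_congr_ae ?_
    filter_upwards [hs] with x hx
    rw [hx.eq]
  rw [integral_frob_isoTensor μ₁ μ₂ lam h h', e]
  ring

/-- A Korn type inequality for periodic gradients. -/
theorem exists_coercive {μ₁ μ₂ lam : ℝ} (hL : (isoTensor n μ₁ μ₂ lam).Admissible) (p : Fin n) :
    ∃ c, 0 < c ∧ ∀ v G, IsW12Per b v G →
      c * ∫ x, frob (G x) (G x) ∂cellMeasure b ≤
        ∫ x, frob (G x) (isoTensor n μ₁ μ₂ lam (G x)) ∂cellMeasure b := by
  obtain ⟨ν₁, ν₂, l, hν, hiso, hsum⟩ := exists_isoTensor_eq hL p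
  have hκ := isoTensor_kappa_pos hL p
  rw [← hsum] at hκ
  refine ⟨min ν₁ (ν₁ + ν₂ + l), lt_min hν hκ, fun v G h => ?_⟩
  rw [← hiso, integral_frob_isoTensor ν₁ ν₂ l h h]
  have h1 := h.integral_trace_sq_le
  have h2 : 0 ≤ ∫ x, (G x).trace * (G x).trace ∂cellMeasure b :=
    integral_nonneg fun x => mul_self_nonneg _
  have h3 : 0 ≤ ∫ x, frob (G x) (G x) ∂cellMeasure b := h2.trans h1
  -- The trace integral lies between 0 and the full norm; which end is the worst case depends on the
  -- sign of its coefficient.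
  rcases le_total 0 (ν₂ + l) with h4 | h4
  · calc _ ≤ ν₁ * ∫ x, frob (G x) (G x) ∂cellMeasure b :=
          mul_le_mul_of_nonneg_right (min_le_left _ _) h3
      _ ≤ _ := le_add_of_nonneg_right (mul_nonneg h4 h2)
  · calc _ ≤ (ν₁ + ν₂ + l) * ∫ x, frob (G x) (G x) ∂cellMeasure b :=
          mul_le_mul_of_nonneg_right (min_le_right _ _) h3
      _ = ν₁ * ∫ x, frob (G x) (G x) ∂cellMeasure b +
          (ν₂ + l) * ∫ x, frob (G x) (G x) ∂cellMeasure b := by ring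
      _ ≤ _ := by
          have := mul_le_mul_of_nonpos_left h1 h4
          linarith

/-! ### Polar fields and the defect -/

variable (b) in
/-- A symmetric periodic gradient field whose trace takes one value on `Ω` and another one off `Ω`.
-/
structure IsPolarField (Ω : Set (EuclideanSpace ℝ (Fin n))) (s θ : ℝ)
    (G : EuclideanSpace ℝ (Fin n) → Matrix (Fin n) (Fin n) ℝ) : Prop where
  grad : ∃ v, IsW12Per b v G
  symm : ∀ᵐ x ∂cellMeasure b, (G x).IsSymm
  trace : ∀ᵐ x ∂cellMeasure b, (G x).trace = s * (phaseChar Ω x - θ)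

variable (b) in
/-- The defect of the field `G` with respect to the polarization `t • 1 = D (t • X)`. -/
noncomputable def defect (Ω : Set (EuclideanSpace ℝ (Fin n))) (D : Tensor n)
    (N : Matrix (Fin n) (Fin n) ℝ) (G : EuclideanSpace ℝ (Fin n) → Matrix (Fin n) (Fin n) ℝ) : ℝ :=
  ∫ x, phaseChar Ω x * frob (G x + N) (D (G x + N)) ∂cellMeasure b

/-- The trace of G₀ is s(χ − θ), and the constant θ drops out because periodic gradients have zero
mean. With s = −t/κ this is the weak form of the equilibrium equation div(L₀G₀ + tχI) = 0. -/
theorem IsPolarField.integral_frob {μ₁ μ₂ lam s θ : ℝ}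
    {G₀ : EuclideanSpace ℝ (Fin n) → Matrix (Fin n) (Fin n) ℝ} (h₀ : IsPolarField b Ω s θ G₀)
    (hΩ : NullMeasurableSet Ω volume) (h : IsW12Per b v G) :
    ∫ x, frob (G x) (isoTensor n μ₁ μ₂ lam (G₀ x)) ∂cellMeasure b =
      (μ₁ + μ₂ + lam) * s * ∫ x, phaseChar Ω x * (G x).trace ∂cellMeasure b := by
  obtain ⟨v₀, hv₀⟩ := h₀.grad
  rw [integral_frob_isoTensor_of_isSymm μ₁ μ₂ lam h hv₀ h₀.symm, mul_assoc]
  congr 1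
  have ht : Integrable (fun x => (G x).trace) (cellMeasure b) :=
    h.matL2.memLp_trace.integrable (by norm_num)
  have e : ∫ x, (G x).trace * (G₀ x).trace ∂cellMeasure b =
      ∫ x, (s * (phaseChar Ω x * (G x).trace) - s * θ * (G x).trace) ∂cellMeasure b := by
    refine integral_congr_ae ?_
    filter_upwards [h₀.trace] with x hx
    rw [hx]; ring
  rw [e, integral_sub ((integrable_phaseChar_mul hΩ ht).const_mul _) (ht.const_mul _),
    integral_const_mul, integral_const_mul, h.integral_trace]
  ring

theorem IsPolarField.integral_phaseChar_trace {s θ : ℝ}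
    {G₀ : EuclideanSpace ℝ (Fin n) → Matrix (Fin n) (Fin n) ℝ} (h₀ : IsPolarField b Ω s θ G₀)
    (hθ : ∫ x, phaseChar Ω x ∂cellMeasure b = θ) :
    ∫ x, phaseChar Ω x * (G₀ x).trace ∂cellMeasure b = s * (θ * (1 - θ)) := by
  have e : ∫ x, phaseChar Ω x * (G₀ x).trace ∂cellMeasure b =
      ∫ x, s * (1 - θ) * phaseChar Ω x ∂cellMeasure b := by
    refine integral_congr_ae ?_
    filter_upwards [h₀.trace] with x hx
    rw [hx]
    linear_combination s * phaseChar_mul_self (Ω := Ω) x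
  rw [e, integral_const_mul, hθ]
  ring

/-- The energy of a periodic gradient field in terms of its distance to a polar field. -/
theorem cellEnergy_eq {μ₁ μ₂ lam θ t : ℝ} {L₁ L₀ : Tensor n}
    {X F : Matrix (Fin n) (Fin n) ℝ}
    {G₀ : EuclideanSpace ℝ (Fin n) → Matrix (Fin n) (Fin n) ℝ}
    (hL₀_eq : L₀ = isoTensor n μ₁ μ₂ lam) (hL₀ : L₀.IsSymmetric) (hD : (L₁ - L₀).IsSymmetric)
    (hX : (L₁ - L₀) X = 1) (hκ : μ₁ + μ₂ + lam ≠ 0)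
    (hΩ : NullMeasurableSet Ω volume) (hθ : ∫ x, phaseChar Ω x ∂cellMeasure b = θ)
    (h₀ : IsPolarField b Ω (-(t / (μ₁ + μ₂ + lam))) θ G₀) (h : IsW12Per b v G) :
    cellEnergy b L₁ L₀ Ω F G = frob F (L₀ F) + 2 * t * θ * F.trace -
      t ^ 2 * θ * (X.trace + (1 - θ) / (μ₁ + μ₂ + lam)) +
      ∫ x, frob (G x - G₀ x) (L₀ (G x - G₀ x)) ∂cellMeasure b +
      defect b Ω (L₁ - L₀) (F - t • X) G := by
  set D := L₁ - L₀ with hDdef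
  set κ := μ₁ + μ₂ + lam with hκdef
  obtain ⟨v₀, hv₀⟩ := id h₀.grad
  have hGL := h.matL2
  have hG₀L := hv₀.matL2
  -- the distance term
  have i1 := hGL.integrable_frob (hGL.tensor L₀)
  have i2 := hGL.integrable_frob (hG₀L.tensor L₀)
  have i3 := hG₀L.integrable_frob (hG₀L.tensor L₀)
  have hS : ∫ x, frob (G x - G₀ x) (L₀ (G x - G₀ x)) ∂cellMeasure b =
      ∫ x, frob (G x) (L₀ (G x)) ∂cellMeasure b +
        2 * t * ∫ x, phaseChar Ω x * (G x).trace ∂cellMeasure b + t ^ 2 / κ * (θ * (1 - θ)) := by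
    simp only [hL₀.frob_sub]
    rw [integral_add (Integrable.sub' i1 (i2.const_mul 2)) i3, integral_sub i1 (i2.const_mul 2),
      integral_const_mul]
    have e1 : ∫ x, frob (G x) (L₀ (G₀ x)) ∂cellMeasure b =
        -t * ∫ x, phaseChar Ω x * (G x).trace ∂cellMeasure b := by
      rw [hL₀_eq, h₀.integral_frob hΩ h, ← hκdef]
      congr 1
      field_simp
    have e2 : ∫ x, frob (G₀ x) (L₀ (G₀ x)) ∂cellMeasure b = t ^ 2 / κ * (θ * (1 - θ)) := by
      rw [hL₀_eq, h₀.integral_frob hΩ hv₀, h₀.integral_phaseChar_trace hθ, ← hκdef]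
      field_simp
    rw [e1, e2]
    ring
  -- the pointwise identity
  have hpt : ∀ x, frob (G x + F) (twoPhase L₁ L₀ Ω x (G x + F)) =
      frob (G x) (L₀ (G x)) + 2 * frob (G x) (L₀ F) + frob F (L₀ F) +
      phaseChar Ω x * frob (G x + (F - t • X)) (D (G x + (F - t • X))) +
      2 * t * (phaseChar Ω x * (G x).trace) +
      (2 * t * F.trace - t ^ 2 * X.trace) * phaseChar Ω x := by
    intro x
    rw [twoPhase_apply, frob_add_right, frob_smul_right, hL₀.frob_add]
    -- As D X = I, the shift by tX produces only trace terms. Their part linear in G is cancelled by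
    -- the cross term of the distance to G₀.
    have hA : G x + F = (G x + (F - t • X)) + t • X := by abel
    have e1 : frob (G x + F) (D (G x + F)) =
        frob (G x + (F - t • X)) (D (G x + (F - t • X))) + 2 * t * (G x).trace +
          2 * t * F.trace - t ^ 2 * X.trace := by
      conv_lhs => rw [hA]
      rw [hD.frob_add, map_smul, hX, frob_smul_right, frob_smul_left, frob_smul_right,
        frob_one_right, frob_one_right, trace_add, trace_sub, trace_smul, smul_eq_mul]
      ring
    rw [e1]
    ring
  have hYL : MatL2 b fun x => G x + (F - t • X) := hGL.add (matL2_const _)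
  have j1 := hGL.integrable_frob (matL2_const (b := b) (L₀ F))
  have j2 := integrable_phaseChar_mul hΩ (hYL.integrable_frob (hYL.tensor D))
  have j3 := integrable_phaseChar_mul hΩ (hGL.memLp_trace.integrable (by norm_num))
  have j4 : Integrable (phaseChar Ω) (cellMeasure b) := (memLp_phaseChar hΩ).integrable (by norm_num)
  have j5 : Integrable (fun _ => frob F (L₀ F)) (cellMeasure b) := integrable_const _
  rw [cellEnergy]
  simp only [hpt]
  rw [integral_add ((((i1.fun_add (j1.const_mul 2)).fun_add j5).fun_add j2).fun_add (j3.const_mul _))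
      (j4.const_mul _),
    integral_add (((i1.fun_add (j1.const_mul 2)).fun_add j5).fun_add j2) (j3.const_mul _),
    integral_add ((i1.fun_add (j1.const_mul 2)).fun_add j5) j2,
    integral_add (i1.fun_add (j1.const_mul 2)) j5, integral_add i1 (j1.const_mul 2),
    integral_const_mul, integral_const_mul, integral_const_mul, h.integral_frob_const, hθ,
    integral_const, hS, defect]
  simp only [probReal_univ, one_smul]
  field_simp
  ring

theorem defect_nonneg {D : Tensor n} (hD : ∀ F, 0 ≤ frob F (D F)) (N : Matrix (Fin n) (Fin n) ℝ)
    (G : EuclideanSpace ℝ (Fin n) → Matrix (Fin n) (Fin n) ℝ) : 0 ≤ defect b Ω D N G :=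
  integral_nonneg fun x => mul_nonneg (phaseChar_nonneg x) (hD _)

theorem defect_neg (D : Tensor n) (N : Matrix (Fin n) (Fin n) ℝ)
    (G : EuclideanSpace ℝ (Fin n) → Matrix (Fin n) (Fin n) ℝ) :
    defect b Ω (-D) N G = -defect b Ω D N G := by
  simp only [defect, LinearMap.neg_apply, frob_neg_right, mul_neg, integral_neg]

theorem defect_eq_zero_iff {D : Tensor n} (hDs : D.IsSymmetric) (hD : ∀ F, 0 ≤ frob F (D F))
    {N : Matrix (Fin n) (Fin n) ℝ} (hΩ : NullMeasurableSet Ω volume) (hG : MatL2 b G) :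
    defect b Ω D N G = 0 ↔ ∀ᵐ x ∂cellMeasure b, x ∈ Ω → D (G x + N) = 0 := by
  have hYL : MatL2 b fun x => G x + N := hG.add (matL2_const _)
  have hi := integrable_phaseChar_mul hΩ (hYL.integrable_frob (hYL.tensor D))
  rw [defect, integral_eq_zero_iff_of_nonneg
    (fun x => mul_nonneg (phaseChar_nonneg x) (hD _)) hi]
  refine Filter.eventually_congr (ae_of_all _ fun x => ?_)
  by_cases hx : x ∈ Ω
  · simp only [phaseChar_of_mem hx, one_mul, Pi.zero_apply, hx, true_imp_iff]
    exact ⟨fun h => hDs.apply_eq_zero hD h, fun h => by rw [h, frob_zero_right]⟩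
  · simp [phaseChar_of_notMem hx, hx]

/-- The parallelogram law bounds a semidefinite form at G' + N by its values at G + N and G − G'.
This transfers a small defect from an approximate minimizer to the polar field. -/
theorem defect_le {D : Tensor n} (hDs : D.IsSymmetric) (hD : ∀ F, 0 ≤ frob F (D F))
    {N : Matrix (Fin n) (Fin n) ℝ} (hΩ : NullMeasurableSet Ω volume) (hG : MatL2 b G)
    (hG' : MatL2 b G') {C : ℝ} (hC : ∀ F, frob F (D F) ≤ C * frob F F) :
    defect b Ω D N G' ≤ 2 * defect b Ω D N G +
      2 * C * ∫ x, frob (G x - G' x) (G x - G' x) ∂cellMeasure b := by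
  have hYL : MatL2 b fun x => G x + N := hG.add (matL2_const _)
  have hYL' : MatL2 b fun x => G' x + N := hG'.add (matL2_const _)
  have hi := integrable_phaseChar_mul hΩ (hYL.integrable_frob (hYL.tensor D))
  have hi' := integrable_phaseChar_mul hΩ (hYL'.integrable_frob (hYL'.tensor D))
  have hd := (hG.sub hG').integrable_frob (hG.sub hG')
  rw [defect, defect, ← integral_const_mul, ← integral_const_mul,
    ← integral_add (hi.const_mul 2) (hd.const_mul (2 * C))]
  refine integral_mono hi' ((hi.const_mul 2).add (hd.const_mul (2 * C))) fun x => ?_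
  have e1 : frob (G' x + N) (D (G' x + N)) + frob ((G x + N) + (G x - G' x))
      (D ((G x + N) + (G x - G' x))) =
      2 * frob (G x + N) (D (G x + N)) + 2 * frob (G x - G' x) (D (G x - G' x)) := by
    have : G' x + N = (G x + N) - (G x - G' x) := by abel
    rw [this, hDs.frob_sub (G x + N) (G x - G' x), hDs.frob_add (G x + N) (G x - G' x)]
    ring
  have h1 := hD ((G x + N) + (G x - G' x))
  have h2 := hC (G x - G' x)
  have h3 := hD (G x - G' x)
  have h4 := phaseChar_nonneg (Ω := Ω) x
  have h5 := phaseChar_le_one (Ω := Ω) x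
  have h6 := mul_le_mul_of_nonneg_left (show frob (G' x + N) (D (G' x + N)) ≤
    2 * frob (G x + N) (D (G x + N)) + 2 * frob (G x - G' x) (D (G x - G' x)) by linarith) h4
  have h7 := mul_le_mul_of_nonneg_right h5 h3
  simp only
  nlinarith

end Identity

/-! ### The bounds and the case of equality -/

section Bounds

variable {n : ℕ} {b : Module.Basis (Fin n) ℝ (EuclideanSpace ℝ (Fin n))}
  {Ω : Set (EuclideanSpace ℝ (Fin n))}

/-- Polar fields exist. -/
theorem exists_isW22Per_isPolarField (b : Module.Basis (Fin n) ℝ (EuclideanSpace ℝ (Fin n)))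
    {θ : ℝ} (hΩ : NullMeasurableSet Ω volume) (hθ : ∫ x, phaseChar Ω x ∂cellMeasure b = θ) :
    ∃ u g H, IsW22Per b u g H ∧ (∀ s, IsPolarField b Ω s θ fun x => s • H x) := by
  have hm : MemLp (fun x => phaseChar Ω x - θ) 2 (cellMeasure b) :=
    (memLp_phaseChar hΩ).sub (memLp_const θ)
  have h0 : ∫ x, (phaseChar Ω x - θ) ∂cellMeasure b = 0 := by
    rw [integral_sub ((memLp_phaseChar hΩ).integrable (by norm_num)) (integrable_const _), hθ]
    simp
  obtain ⟨u, g, H, hu, htr⟩ := exists_poisson hm h0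
  obtain ⟨v, hv⟩ := hu.exists_isW12Per
  refine ⟨u, g, H, hu, fun s => ⟨⟨_, hv.smul s⟩, ?_, ?_⟩⟩
  · filter_upwards [hu.hess_symm] with x hx
    rw [IsSymm, transpose_smul, hx.eq]
  · filter_upwards [htr] with x hx
    rw [trace_smul, hx, smul_eq_mul]

theorem isGLB_cellEnergy {L₁ L₀ Le : Tensor n} (hLe : IsEffectiveTensor b L₁ L₀ Ω Le)
    (F : Matrix (Fin n) (Fin n) ℝ) :
    IsGLB {e | ∃ v G, IsW12Per b v G ∧ e = cellEnergy b L₁ L₀ Ω F G} (frob F (Le F)) := by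
  have h := hLe.2 F
  constructor
  · rintro _ ⟨v, G, hG, rfl⟩
    have := h.1 (mem_energies_iff.2 ⟨v, G, hG, rfl⟩)
    linarith
  · intro a ha
    have : 1 / 2 * a ≤ 1 / 2 * frob F (Le F) := h.2 (by
      intro e he
      obtain ⟨v, G, hG, rfl⟩ := mem_energies_iff.1 he
      have := ha ⟨v, G, hG, rfl⟩
      linarith)
    linarith

variable {μ₁ μ₂ lam θ t : ℝ} {L₁ L₀ Le : Tensor n} {X F : Matrix (Fin n) (Fin n) ℝ}
  {G₀ : EuclideanSpace ℝ (Fin n) → Matrix (Fin n) (Fin n) ℝ}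

/-- The value of the bounds, as a function of the polarization `t`. -/
noncomputable def polarBound (L₀ : Tensor n) (κ θ t : ℝ) (X F : Matrix (Fin n) (Fin n) ℝ) : ℝ :=
  frob F (L₀ F) + 2 * t * θ * F.trace - t ^ 2 * θ * (X.trace + (1 - θ) / κ)

/-- The value of t is the critical point of the quadratic polynomial, whose leading coefficient is
−θd/κ. -/
theorem polarBound_eq {κ d : ℝ} (hκ : κ ≠ 0) (hd : d = κ * X.trace + (1 - θ)) (hd0 : d ≠ 0)
    (ht : t = κ * F.trace / d) :
    polarBound L₀ κ θ t X F = frob F (L₀ F) + θ * κ / d * F.trace ^ 2 := by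
  have e : X.trace + (1 - θ) / κ = d / κ := by rw [hd]; field_simp
  rw [polarBound, e, ht]
  field_simp
  ring

/-- The lower bound, and the condition for equality. -/
theorem lower_bound (hL₀_eq : L₀ = isoTensor n μ₁ μ₂ lam) (hL₀ : L₀.Admissible) (p : Fin n)
    (hD : (L₁ - L₀).IsSymmetric) (hX : (L₁ - L₀) X = 1) (hpos : ∀ F, 0 ≤ frob F ((L₁ - L₀) F))
    (hΩ : NullMeasurableSet Ω volume) (hθ : ∫ x, phaseChar Ω x ∂cellMeasure b = θ)
    (hLe : IsEffectiveTensor b L₁ L₀ Ω Le)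
    (h₀ : IsPolarField b Ω (-(t / (μ₁ + μ₂ + lam))) θ G₀) :
    polarBound L₀ (μ₁ + μ₂ + lam) θ t X F ≤ frob F (Le F) ∧
      (frob F (Le F) = polarBound L₀ (μ₁ + μ₂ + lam) θ t X F ↔
        ∀ᵐ x ∂cellMeasure b, x ∈ Ω → (L₁ - L₀) (G₀ x + (F - t • X)) = 0) := by
  have hκ : μ₁ + μ₂ + lam ≠ 0 := (isoTensor_kappa_pos (hL₀_eq ▸ hL₀) p).ne'
  have hglb := isGLB_cellEnergy hLe F
  have hid : ∀ v G, IsW12Per b v G → cellEnergy b L₁ L₀ Ω F G =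
      polarBound L₀ (μ₁ + μ₂ + lam) θ t X F +
        ∫ x, frob (G x - G₀ x) (L₀ (G x - G₀ x)) ∂cellMeasure b +
        defect b Ω (L₁ - L₀) (F - t • X) G := fun v G h =>
    cellEnergy_eq hL₀_eq hL₀.1 hD hX hκ hΩ hθ h₀ h
  have hle : polarBound L₀ (μ₁ + μ₂ + lam) θ t X F ≤ frob F (Le F) := by
    refine hglb.2 ?_
    rintro _ ⟨v, G, hG, rfl⟩
    rw [hid v G hG]
    have h1 : 0 ≤ ∫ x, frob (G x - G₀ x) (L₀ (G x - G₀ x)) ∂cellMeasure b :=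
      integral_nonneg fun x => hL₀.nonneg _
    have h2 := defect_nonneg (b := b) (Ω := Ω) hpos (F - t • X) G
    linarith
  obtain ⟨v₀, hv₀⟩ := h₀.grad
  refine ⟨hle, ?_⟩
  rw [← defect_eq_zero_iff hD hpos hΩ hv₀.matL2]
  constructor
  · intro heq
    -- Attainment of the infimum is not assumed. A near-minimizer has small defect and, by
    -- coercivity of L₀, lies close to G₀, so the defect of G₀ is arbitrarily small.
    refine le_antisymm (le_of_forall_pos_le_add fun ε hε => ?_) (defect_nonneg hpos _ _)
    obtain ⟨c, hc, hcoer⟩ := exists_coercive (b := b) (hL₀_eq ▸ hL₀) p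
    obtain ⟨C, hC0, hC⟩ := (L₁ - L₀).exists_bound
    -- Chosen so that 2δ + 2C(δ/c) = ε: the defect of the near-minimizer is at most δ and its
    -- squared distance to G₀ at most δ/c.
    set δ := ε / (2 + 2 * C / c) with hδ
    have hδ0 : 0 < δ := by positivity
    obtain ⟨_, ⟨v, G, hG, rfl⟩, hlt⟩ := (isGLB_lt_iff hglb).1
      (show frob F (Le F) < frob F (Le F) + δ by linarith)
    rw [hid v G hG, heq] at hlt
    have h2 := defect_nonneg (b := b) (Ω := Ω) hpos (F - t • X) G
    have h3 : c * ∫ x, frob (G x - G₀ x) (G x - G₀ x) ∂cellMeasure b ≤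
        ∫ x, frob (G x - G₀ x) (L₀ (G x - G₀ x)) ∂cellMeasure b := by
      have hsub := hG.add (hv₀.smul (-1))
      have e : ∀ x, G x + (-1 : ℝ) • G₀ x = G x - G₀ x := fun x => by
        rw [neg_one_smul, ← sub_eq_add_neg]
      have := hcoer _ _ hsub
      simp only [e] at this
      rwa [← hL₀_eq] at this
    have h1 : 0 ≤ ∫ x, frob (G x - G₀ x) (G x - G₀ x) ∂cellMeasure b :=
      integral_nonneg fun x => frob_self_nonneg _
    have h4 := defect_le hD hpos (N := F - t • X) hΩ hG.matL2 hv₀.matL2 hC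
    set I := ∫ x, frob (G x - G₀ x) (G x - G₀ x) ∂cellMeasure b
    have h5 : c * I ≤ δ := by linarith
    have h6 : I ≤ δ / c := by rw [le_div_iff₀ hc]; linarith
    have h7 : defect b Ω (L₁ - L₀) (F - t • X) G ≤ δ := by nlinarith
    have h8 : 2 * C * I ≤ 2 * C * (δ / c) := mul_le_mul_of_nonneg_left h6 (by positivity)
    have h9 : 2 * δ + 2 * C * (δ / c) = ε := by
      rw [hδ]; field_simp
    linarith
  · intro h0
    refine le_antisymm ?_ hle
    have h1 := hglb.1 ⟨v₀, G₀, hv₀, rfl⟩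
    rw [hid v₀ G₀ hv₀, h0] at h1
    simpa [frob_zero_right] using h1

/-- The upper bound, and the condition for equality. -/
theorem upper_bound (hL₀_eq : L₀ = isoTensor n μ₁ μ₂ lam) (hL₀ : L₀.Admissible)
    (hL₁ : L₁.Admissible) (p : Fin n)
    (hD : (L₁ - L₀).IsSymmetric) (hX : (L₁ - L₀) X = 1)
    (hneg : ∀ F, 0 ≤ frob F ((-(L₁ - L₀)) F))
    (hΩ : NullMeasurableSet Ω volume) (hθ : ∫ x, phaseChar Ω x ∂cellMeasure b = θ)
    (hLe : IsEffectiveTensor b L₁ L₀ Ω Le)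
    (h₀ : IsPolarField b Ω (-(t / (μ₁ + μ₂ + lam))) θ G₀) :
    frob F (Le F) ≤ polarBound L₀ (μ₁ + μ₂ + lam) θ t X F ∧
      (frob F (Le F) = polarBound L₀ (μ₁ + μ₂ + lam) θ t X F ↔
        ∀ᵐ x ∂cellMeasure b, x ∈ Ω → (L₁ - L₀) (G₀ x + (F - t • X)) = 0) := by
  have hκ : μ₁ + μ₂ + lam ≠ 0 := (isoTensor_kappa_pos (hL₀_eq ▸ hL₀) p).ne'
  have hglb := isGLB_cellEnergy hLe F
  have hid : ∀ v G, IsW12Per b v G → cellEnergy b L₁ L₀ Ω F G =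
      polarBound L₀ (μ₁ + μ₂ + lam) θ t X F +
        ∫ x, frob (G x - G₀ x) (L₀ (G x - G₀ x)) ∂cellMeasure b +
        defect b Ω (L₁ - L₀) (F - t • X) G := fun v G h =>
    cellEnergy_eq hL₀_eq hL₀.1 hD hX hκ hΩ hθ h₀ h
  obtain ⟨v₀, hv₀⟩ := h₀.grad
  -- With G₀ as trial field the distance term disappears and the remaining defect is nonpositive.
  have h1 := hglb.1 ⟨v₀, G₀, hv₀, rfl⟩
  rw [hid v₀ G₀ hv₀] at h1
  simp only [sub_self, map_zero, frob_zero_right, integral_zero, add_zero] at h1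
  have h2 := defect_nonneg (b := b) (Ω := Ω) hneg (F - t • X) G₀
  have h3 := defect_neg (b := b) (Ω := Ω) (L₁ - L₀) (F - t • X) G₀
  have hle : frob F (Le F) ≤ polarBound L₀ (μ₁ + μ₂ + lam) θ t X F := by linarith
  have hzero := defect_eq_zero_iff hD.neg hneg (N := F - t • X) hΩ hv₀.matL2
  simp only [LinearMap.neg_apply, neg_eq_zero] at hzero
  refine ⟨hle, ?_⟩
  rw [← hzero]
  constructor
  · intro heq
    linarith
  · intro h0
    refine le_antisymm hle (hglb.2 ?_)
    rintro _ ⟨v, G, hG, rfl⟩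
    rw [hid v G hG]
    have hL := hG.matL2.sub hv₀.matL2
    have i1 := hL.integrable_frob (hL.tensor L₀)
    have i2 := integrable_phaseChar_mul hΩ (hL.integrable_frob (hL.tensor (L₁ - L₀)))
    -- On Ω, D annihilates G₀ + F − tX, so the defect of G depends on G − G₀ only. Added to the
    -- distance term it is the two-phase energy of G − G₀, nonnegative by admissibility of both
    -- phases; hence G₀ is a minimizer.
    have e : defect b Ω (L₁ - L₀) (F - t • X) G =
        ∫ x, phaseChar Ω x * frob (G x - G₀ x) ((L₁ - L₀) (G x - G₀ x)) ∂cellMeasure b := by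
      refine integral_congr_ae ?_
      filter_upwards [hzero.1 h0] with x hx
      by_cases hxΩ : x ∈ Ω
      · have : G x + (F - t • X) = (G x - G₀ x) + (G₀ x + (F - t • X)) := by abel
        rw [this, hD.frob_add, hx hxΩ, frob_zero_right, frob_zero_right]
        ring
      · simp only [phaseChar_of_notMem hxΩ, zero_mul]
    have h4 : 0 ≤ ∫ x, (frob (G x - G₀ x) (L₀ (G x - G₀ x)) +
        phaseChar Ω x * frob (G x - G₀ x) ((L₁ - L₀) (G x - G₀ x))) ∂cellMeasure b := by
      refine integral_nonneg fun x => ?_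
      have := twoPhase_nonneg (Ω := Ω) hL₀ hL₁ x (G x - G₀ x)
      rwa [twoPhase_apply, frob_add_right, frob_smul_right] at this
    rw [integral_add i1 i2, ← e] at h4
    linarith

/-! ### Periodic E-inclusions and the denominator -/

theorem volFrac_diff (hΩ : MeasurableSet Ω) (hΩY : Ω ⊆ unitCell b) :
    volFrac b (unitCell b \ Ω) = 1 - volFrac b Ω := by
  rw [volFrac, volFrac, measureReal_sdiff hΩY hΩ
    (volume_unitCell_ne_top b), sub_div,
    div_self volume_real_unitCell_ne_zero]

theorem ae_restrict_iff_cell (hΩ : MeasurableSet Ω) (hΩY : Ω ⊆ unitCell b)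
    {P : EuclideanSpace ℝ (Fin n) → Prop} :
    (∀ᵐ x ∂volume.restrict Ω, P x) ↔ ∀ᵐ x ∂cellMeasure b, x ∈ Ω → P x := by
  rw [ae_restrict_iff' hΩ, ae_cellMeasure_iff, ae_restrict_iff' (measurableSet_unitCell b)]
  exact Filter.eventually_congr (ae_of_all _ fun x => ⟨fun h _ => h, fun h hx => h (hΩY hx) hx⟩)

theorem trace_optimalQ (κ : ℝ) (hF : F.trace ≠ 0) : (optimalQ L₁ L₀ κ θ F).trace = 1 := by
  rw [optimalQ, trace_add, trace_smul, trace_smul, smul_eq_mul, smul_eq_mul, div_mul_cancel₀ _ hF]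
  ring

/-- The right side is the constant value tX − F that a polar field with vanishing defect takes on Ω.
Its trace is −(t/κ)(1−θ), and Q is this matrix normalized to trace one. -/
theorem smul_optimalQ {κ : ℝ} (hκ : κ ≠ 0) (hθ : θ < 1) (hF : F.trace ≠ 0)
    (hd : boundDenom L₁ L₀ κ θ ≠ 0) (ht : t = κ * F.trace / boundDenom L₁ L₀ κ θ) :
    (-(t / κ) * (1 - θ)) • optimalQ L₁ L₀ κ θ F = t • (-(L₀ - L₁).inv 1) - F := by
  have h1 : (1 - θ) ≠ 0 := by linarith
  rw [optimalQ, smul_add, smul_smul, smul_smul]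
  have e1 : -(t / κ) * (1 - θ) * ((1 - κ / (1 - θ) * ((L₀ - L₁).inv 1).trace) / F.trace) = -1 := by
    have : 1 - κ / (1 - θ) * ((L₀ - L₁).inv 1).trace = boundDenom L₁ L₀ κ θ / (1 - θ) := by
      rw [boundDenom]; field_simp
    rw [this, ht]
    field_simp
  have e2 : -(t / κ) * (1 - θ) * (κ / (1 - θ)) = -t := by field_simp
  rw [e1, e2, neg_smul, one_smul, neg_smul, smul_neg]
  abel

/-- A periodic E-inclusion gives a polar field with vanishing defect. -/
theorem IsPeriodicEInclusion.exists_isPolarField {κ : ℝ} (hκ : κ ≠ 0) (hθ : θ < 1)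
    (hF : F.trace ≠ 0) (hd : boundDenom L₁ L₀ κ θ ≠ 0)
    (ht : t = κ * F.trace / boundDenom L₁ L₀ κ θ) (hvol : volFrac b Ω = θ)
    (h : IsPeriodicEInclusion b Ω (optimalQ L₁ L₀ κ θ F)) :
    ∃ G₀, IsPolarField b Ω (-(t / κ)) θ G₀ ∧
      ∀ᵐ x ∂cellMeasure b, x ∈ Ω → (L₁ - L₀) (G₀ x + (F - t • (-(L₀ - L₁).inv 1))) = 0 := by
  obtain ⟨hΩ, hΩY, -, u, g, H, p₀, hu, hp₀, htr, hQ⟩ := h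
  rw [volFrac_diff hΩ.measurableSet hΩY, hvol, trace_optimalQ κ hF, one_mul] at hp₀
  rw [← ae_cellMeasure_iff, trace_optimalQ κ hF] at htr
  rw [ae_restrict_iff_cell hΩ.measurableSet hΩY] at hQ
  obtain ⟨v, hv⟩ := hu.exists_isW12Per
  -- The Laplacian of u is 1 on Ω and −θ/(1−θ) off it, so the factor 1 − θ turns it into χ − θ.
  refine ⟨fun x => (-(t / κ) * (1 - θ)) • H x, ⟨⟨_, hv.smul _⟩, ?_, ?_⟩, ?_⟩
  · filter_upwards [hu.hess_symm] with x hx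
    rw [IsSymm, transpose_smul, hx.eq]
  · filter_upwards [htr] with x hx
    rw [trace_smul, hx, smul_eq_mul]
    by_cases hxΩ : x ∈ Ω
    · rw [if_pos hxΩ, phaseChar_of_mem hxΩ]; ring
    · rw [if_neg hxΩ, phaseChar_of_notMem hxΩ]
      linear_combination -(t / κ) * hp₀
  · filter_upwards [hQ] with x hx hxΩ
    rw [hx hxΩ, smul_optimalQ hκ hθ hF hd ht]
    rw [show ∀ A B : Matrix (Fin n) (Fin n) ℝ, A - B + (B - A) = 0 from fun A B => by abel, map_zero]

/-- A polar field with vanishing defect gives a periodic E-inclusion. -/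
theorem isPeriodicEInclusion_of_polar {κ : ℝ} (hκ : κ ≠ 0) (hθ₀ : 0 < θ) (hθ : θ < 1)
    (hF : F.trace ≠ 0) (hFs : F.IsSymm) (hd : boundDenom L₁ L₀ κ θ ≠ 0)
    (ht : t = κ * F.trace / boundDenom L₁ L₀ κ θ) (hΩ : IsOpen Ω) (hΩY : Ω ⊆ unitCell b)
    (hvol : volFrac b Ω = θ) (hT : (L₀ - L₁).IsSymmetric)
    (hrange : ∀ S : Matrix (Fin n) (Fin n) ℝ, S.IsSymm → S ∈ LinearMap.range (L₀ - L₁))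
    {u : EuclideanSpace ℝ (Fin n) → ℝ} {g : Fin n → EuclideanSpace ℝ (Fin n) → ℝ}
    {H : EuclideanSpace ℝ (Fin n) → Matrix (Fin n) (Fin n) ℝ} (hu : IsW22Per b u g H)
    (hpol : IsPolarField b Ω (-(t / κ)) θ fun x => (-(t / κ)) • H x)
    (hzero : ∀ᵐ x ∂cellMeasure b, x ∈ Ω →
      (L₁ - L₀) ((-(t / κ)) • H x + (F - t • (-(L₀ - L₁).inv 1))) = 0) :
    IsPeriodicEInclusion b Ω (optimalQ L₁ L₀ κ θ F) := by
  have h1 : (1 - θ) ≠ 0 := by linarith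
  have ht0 : t ≠ 0 := by rw [ht]; exact div_ne_zero (mul_ne_zero hκ hF) hd
  have hs0 : -(t / κ) ≠ 0 := neg_ne_zero.2 (div_ne_zero ht0 hκ)
  have h1r : (1 : Matrix (Fin n) (Fin n) ℝ) ∈ LinearMap.range (L₀ - L₁) := hrange 1 isSymm_one
  obtain ⟨hi1, hi2⟩ := Tensor.inv_spec hT h1r
  have hHQ : ∀ᵐ x ∂cellMeasure b, x ∈ Ω → (1 - θ)⁻¹ • H x = optimalQ L₁ L₀ κ θ F := by
    filter_upwards [hzero, hpol.symm] with x hx hsx hxΩ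
    have hz := hx hxΩ
    set M := (-(t / κ)) • H x with hM
    have hMF : (M + F).IsSymm := hsx.add hFs
    have hz' : (L₀ - L₁) (M + F + t • (L₀ - L₁).inv 1) = 0 := by
      rw [← neg_sub L₁ L₀, LinearMap.neg_apply, neg_sub, neg_eq_zero, ← hz]
      congr 1
      rw [smul_neg]
      abel
    -- Symmetry of M + F puts this sum in the range of ΔL. It is also in the kernel, and a symmetric
    -- tensor is injective on its range, so the sum is zero.
    have hmem : M + F + t • (L₀ - L₁).inv 1 ∈ LinearMap.range (L₀ - L₁) :=
      Submodule.add_mem _ (hrange _ hMF) (Submodule.smul_mem _ _ hi1)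
    have huniq := (existsUnique_mem_range hT (Submodule.zero_mem _)).unique ⟨hmem, hz'⟩
      ⟨Submodule.zero_mem _, map_zero _⟩
    have hMeq : M = (-(t / κ) * (1 - θ)) • optimalQ L₁ L₀ κ θ F := by
      rw [smul_optimalQ hκ hθ hF hd ht, smul_neg]
      have : M = (M + F + t • (L₀ - L₁).inv 1) - F - t • (L₀ - L₁).inv 1 := by abel
      rw [this, huniq]
      abel
    rw [hM, mul_smul] at hMeq
    have := smul_right_injective _ hs0 hMeq
    rw [this, smul_smul, inv_mul_cancel₀ h1, one_smul]
  have hsymm : ∀ᵐ x ∂cellMeasure b, (H x).IsSymm := hu.hess_symm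
  have hQs : (optimalQ L₁ L₀ κ θ F).IsSymm := by
    -- Positive measure yields a point of Ω where the Hessian is symmetric and proportional to Q;
    -- the symmetry of Q is read off there.
    have hpos : cellMeasure b Ω ≠ 0 := by
      intro h0
      have : ∀ᵐ x ∂cellMeasure b, phaseChar Ω x = 0 := by
        filter_upwards [measure_eq_zero_iff_ae_notMem.1 h0] with x hx
        exact phaseChar_of_notMem hx
      have h2 := integral_phaseChar (b := b) hΩ.measurableSet.nullMeasurableSet hΩY
      rw [integral_congr_ae this, integral_zero, hvol] at h2
      linarith
    have hfreq : ∃ᵐ x ∂cellMeasure b, x ∈ Ω := frequently_ae_mem_iff.2 hpos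
    obtain ⟨x, hxΩ, hx1, hx2⟩ := (hfreq.and_eventually (hHQ.and hsymm)).exists
    rw [← hx1 hxΩ, IsSymm, transpose_smul, hx2.eq]
  -- As Tr Q = 1, the mean-zero condition forces this value of p₀.
  refine ⟨hΩ, hΩY, hQs, _, _, _, -θ / (1 - θ), hu.smul (1 - θ)⁻¹, ?_, ?_, ?_⟩
  · rw [volFrac_diff hΩ.measurableSet hΩY, hvol, trace_optimalQ κ hF]
    field_simp
    ring
  · rw [← ae_cellMeasure_iff, trace_optimalQ κ hF]
    filter_upwards [hpol.trace] with x hx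
    rw [trace_smul, smul_eq_mul] at hx
    have hx' := mul_left_cancel₀ hs0 hx
    rw [trace_smul, hx', smul_eq_mul]
    by_cases hxΩ : x ∈ Ω
    · rw [if_pos hxΩ, phaseChar_of_mem hxΩ, inv_mul_cancel₀ h1]
    · rw [if_neg hxΩ, phaseChar_of_notMem hxΩ]
      field_simp
      ring
  · rwa [ae_restrict_iff_cell hΩ.measurableSet hΩY]

/-- Vanishing of the defect characterizes periodic E-inclusions. -/
theorem eq_polarBound_iff_isPeriodicEInclusion {κ : ℝ} (hκ : κ ≠ 0) (hθ₀ : 0 < θ) (hθ : θ < 1)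
    (hF : F.trace ≠ 0) (hFs : F.IsSymm) (hd : boundDenom L₁ L₀ κ θ ≠ 0)
    (ht : t = κ * F.trace / boundDenom L₁ L₀ κ θ) (hΩ : IsOpen Ω) (hΩY : Ω ⊆ unitCell b)
    (hvol : volFrac b Ω = θ) (hT : (L₀ - L₁).IsSymmetric)
    (hrange : ∀ S : Matrix (Fin n) (Fin n) ℝ, S.IsSymm → S ∈ LinearMap.range (L₀ - L₁)) {P : Prop}
    (hP : ∀ G₀, IsPolarField b Ω (-(t / κ)) θ G₀ → (P ↔
      ∀ᵐ x ∂cellMeasure b, x ∈ Ω → (L₁ - L₀) (G₀ x + (F - t • (-(L₀ - L₁).inv 1))) = 0)) :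
    P ↔ IsPeriodicEInclusion b Ω (optimalQ L₁ L₀ κ θ F) := by
  have hθ' := (integral_phaseChar hΩ.measurableSet.nullMeasurableSet hΩY).trans hvol
  constructor
  · intro hp
    obtain ⟨u, g, H, hu, hpol⟩ :=
      exists_isW22Per_isPolarField b hΩ.measurableSet.nullMeasurableSet hθ'
    exact isPeriodicEInclusion_of_polar hκ hθ₀ hθ hF hFs hd ht hΩ hΩY hvol hT hrange hu
      (hpol _) ((hP _ (hpol _)).1 hp)
  · intro h
    -- The equality criterion is assumed for every polar field, so the one built from the
    -- E-inclusion need not be matched with the one built from the Poisson equation.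
    obtain ⟨G₀, hG₀, hz⟩ := h.exists_isPolarField hκ hθ hF hd ht hvol
    exact (hP G₀ hG₀).2 hz

/-- Testing L₁ − L₀ ≥ 0 on ΔL⁻¹I shows that Tr(ΔL⁻¹I) ≤ 0. -/
theorem boundDenom_pos_of_le {κ : ℝ} (hκ : 0 ≤ κ) (hθ : θ < 1) (hT : (L₀ - L₁).IsSymmetric)
    (h1 : (1 : Matrix (Fin n) (Fin n) ℝ) ∈ LinearMap.range (L₀ - L₁)) (h : L₀.Le L₁) :
    0 < boundDenom L₁ L₀ κ θ := by
  have hi := (Tensor.inv_spec hT h1).2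
  have h2 := h ((L₀ - L₁).inv 1)
  rw [← neg_sub L₀ L₁, LinearMap.neg_apply, hi, frob_neg_right, frob_one_right] at h2
  rw [boundDenom]
  nlinarith

/-- Take E = eₚ ⊗ eₚ. Cauchy–Schwarz for ΔL ≥ 0 gives 1 = (Tr E)² ≤ (E·ΔL E) Tr(ΔL⁻¹I), and E·ΔL E ≤
E·L₀E = κ because L₁ is nonnegative. Hence κ Tr(ΔL⁻¹I) ≥ 1 > 1 − θ. -/
theorem boundDenom_neg_of_le (hL₀_eq : L₀ = isoTensor n μ₁ μ₂ lam) (hL₁ : L₁.Admissible) (p : Fin n) (hθ₀ : 0 < θ) (hT : (L₀ - L₁).IsSymmetric)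
    (h1 : (1 : Matrix (Fin n) (Fin n) ℝ) ∈ LinearMap.range (L₀ - L₁)) (h : L₁.Le L₀) :
    boundDenom L₁ L₀ (μ₁ + μ₂ + lam) θ < 0 := by
  have hi := (Tensor.inv_spec hT h1).2
  set E := Matrix.single p p (1 : ℝ) with hE
  have hcs := hT.sq_frob_le h E ((L₀ - L₁).inv 1)
  rw [hi, frob_one_right, frob_one_right] at hcs
  have e1 : E.trace = 1 := by simp [hE]
  have e2 : frob E (L₀ E) = μ₁ + μ₂ + lam := by
    rw [hL₀_eq, frob_isoTensor, e1, hE, transpose_single, frob_single]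
    simp
  have e3 : frob E ((L₀ - L₁) E) ≤ μ₁ + μ₂ + lam := by
    rw [LinearMap.sub_apply, frob_sub_right, e2]
    linarith [hL₁.nonneg E]
  have e4 : 0 ≤ ((L₀ - L₁).inv 1).trace := by
    have := h ((L₀ - L₁).inv 1)
    rwa [hi, frob_one_right] at this
  have e5 := mul_le_mul_of_nonneg_right e3 e4
  rw [e1] at hcs
  rw [boundDenom]
  linarith

end Bounds

end TwoPhase

/-! ### The main theorem -/

theorem mainTheorem3 {n : ℕ} (b : Module.Basis (Fin n) ℝ (EuclideanSpace ℝ (Fin n)))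
    (θ : ℝ) (hθ₀ : 0 < θ) (hθ₁ : θ < 1)
    (μ₁ μ₂ lam : ℝ) (L₁ L₀ : TwoPhase.Tensor n)
    (hL₀_eq : L₀ = TwoPhase.isoTensor n μ₁ μ₂ lam)
    (hL₀ : L₀.Admissible) (hL₁ : L₁.Admissible)
    (hrange : ∀ S : Matrix (Fin n) (Fin n) ℝ, S.IsSymm → S ∈ LinearMap.range (L₀ - L₁)) :
    -- the effective tensor is well defined
    (∀ Ω : Set (EuclideanSpace ℝ (Fin n)), Ω ⊆ TwoPhase.unitCell b →
      MeasureTheory.NullMeasurableSet Ω MeasureTheory.volume →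
      TwoPhase.volFrac b Ω = θ →
      ∃! Le : TwoPhase.Tensor n, TwoPhase.IsEffectiveTensor b L₁ L₀ Ω Le) ∧
    -- lower bound, and the case of equality
    (L₀.Le L₁ →
      TwoPhase.boundDenom L₁ L₀ (μ₁ + μ₂ + lam) θ ≠ 0 ∧
      ∀ (Ω : Set (EuclideanSpace ℝ (Fin n))) (Le : TwoPhase.Tensor n)
        (F : Matrix (Fin n) (Fin n) ℝ),
        Ω ⊆ TwoPhase.unitCell b →
        MeasureTheory.NullMeasurableSet Ω MeasureTheory.volume →
        TwoPhase.volFrac b Ω = θ →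
        TwoPhase.IsEffectiveTensor b L₁ L₀ Ω Le → F.IsSymm →
        TwoPhase.bound L₁ L₀ (μ₁ + μ₂ + lam) θ F ≤
          TwoPhase.frob F (Le F) - TwoPhase.frob F (L₀ F) ∧
        (F.trace ≠ 0 → IsOpen Ω →
          (TwoPhase.frob F (Le F) - TwoPhase.frob F (L₀ F) =
              TwoPhase.bound L₁ L₀ (μ₁ + μ₂ + lam) θ F ↔
            TwoPhase.IsPeriodicEInclusion b Ω
              (TwoPhase.optimalQ L₁ L₀ (μ₁ + μ₂ + lam) θ F)))) ∧
    -- upper bound, and the case of equality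
    (L₁.Le L₀ →
      TwoPhase.boundDenom L₁ L₀ (μ₁ + μ₂ + lam) θ ≠ 0 ∧
      ∀ (Ω : Set (EuclideanSpace ℝ (Fin n))) (Le : TwoPhase.Tensor n)
        (F : Matrix (Fin n) (Fin n) ℝ),
        Ω ⊆ TwoPhase.unitCell b →
        MeasureTheory.NullMeasurableSet Ω MeasureTheory.volume →
        TwoPhase.volFrac b Ω = θ →
        TwoPhase.IsEffectiveTensor b L₁ L₀ Ω Le → F.IsSymm →
        TwoPhase.frob F (Le F) - TwoPhase.frob F (L₀ F) ≤
          TwoPhase.bound L₁ L₀ (μ₁ + μ₂ + lam) θ F ∧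
        (F.trace ≠ 0 → IsOpen Ω →
          (TwoPhase.frob F (Le F) - TwoPhase.frob F (L₀ F) =
              TwoPhase.bound L₁ L₀ (μ₁ + μ₂ + lam) θ F ↔
            TwoPhase.IsPeriodicEInclusion b Ω
              (TwoPhase.optimalQ L₁ L₀ (μ₁ + μ₂ + lam) θ F)))) := by
  have hT : (L₀ - L₁).IsSymmetric := hL₀.1.sub hL₁.1
  have hD : (L₁ - L₀).IsSymmetric := hL₁.1.sub hL₀.1
  have h1r := hrange 1 Matrix.isSymm_one
  have hX : (L₁ - L₀) (-(L₀ - L₁).inv 1) = 1 := by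
    rw [← neg_sub L₀ L₁, LinearMap.neg_apply, map_neg, neg_neg]
    exact (TwoPhase.Tensor.inv_spec hT h1r).2
  refine ⟨fun Ω _ hΩ _ => TwoPhase.existsUnique_isEffectiveTensor hL₀ hL₁ hΩ, ?_⟩
  -- In dimension zero there is no unit matrix from which to get κ > 0, but all traces and inner
  -- products vanish and the denominator is 1 − θ.
  rcases n.eq_zero_or_pos with rfl | hn
  · have htr : ∀ F : Matrix (Fin 0) (Fin 0) ℝ, F.trace = 0 := fun F => by simp [Matrix.trace]
    have hd : TwoPhase.boundDenom L₁ L₀ (μ₁ + μ₂ + lam) θ ≠ 0 := by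
      rw [TwoPhase.boundDenom, htr]
      linarith
    have hb : ∀ F, TwoPhase.bound L₁ L₀ (μ₁ + μ₂ + lam) θ F = 0 := fun F => by
      rw [TwoPhase.bound, htr]; simp
    have hf : ∀ F G : Matrix (Fin 0) (Fin 0) ℝ, TwoPhase.frob F G = 0 := fun F G => by
      simp [TwoPhase.frob]
    refine ⟨fun _ => ⟨hd, fun Ω Le F _ _ _ _ _ => ⟨?_, fun h => absurd (htr F) h⟩⟩,
      fun _ => ⟨hd, fun Ω Le F _ _ _ _ _ => ⟨?_, fun h => absurd (htr F) h⟩⟩⟩ <;>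
    simp [hb, hf]
  have hκ : 0 < μ₁ + μ₂ + lam := TwoPhase.isoTensor_kappa_pos (hL₀_eq ▸ hL₀) ⟨0, hn⟩
  have hdeq : TwoPhase.boundDenom L₁ L₀ (μ₁ + μ₂ + lam) θ =
      (μ₁ + μ₂ + lam) * (-(L₀ - L₁).inv 1).trace + (1 - θ) := by
    rw [TwoPhase.boundDenom, Matrix.trace_neg]; ring
  have hval : ∀ F, TwoPhase.boundDenom L₁ L₀ (μ₁ + μ₂ + lam) θ ≠ 0 →
      TwoPhase.polarBound L₀ (μ₁ + μ₂ + lam) θ ((μ₁ + μ₂ + lam) * F.trace /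
        TwoPhase.boundDenom L₁ L₀ (μ₁ + μ₂ + lam) θ) (-(L₀ - L₁).inv 1) F =
      TwoPhase.frob F (L₀ F) + TwoPhase.bound L₁ L₀ (μ₁ + μ₂ + lam) θ F := fun F hd =>
    TwoPhase.polarBound_eq hκ.ne' hdeq hd rfl
  constructor
  · intro hle
    have hd := (TwoPhase.boundDenom_pos_of_le hκ.le hθ₁ hT h1r hle).ne'
    refine ⟨hd, fun Ω Le F hΩY hΩ hvol hLe hFs => ?_⟩
    have hθ := (TwoPhase.integral_phaseChar hΩ hΩY).trans hvol
    -- Any one polar field suffices for the inequality; the equality case keeps the criterion for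
    -- all of them.
    obtain ⟨u, g, H, -, hpol⟩ := TwoPhase.exists_isW22Per_isPolarField b hΩ hθ
    have key := fun G₀ hG₀ => TwoPhase.lower_bound (G₀ := G₀) (F := F)
      (t := (μ₁ + μ₂ + lam) * F.trace / TwoPhase.boundDenom L₁ L₀ (μ₁ + μ₂ + lam) θ)
      hL₀_eq hL₀ ⟨0, hn⟩ hD hX hle hΩ hθ hLe hG₀
    rw [hval F hd] at key
    refine ⟨by linarith [(key _ (hpol _)).1], fun hF hΩo => ?_⟩
    rw [sub_eq_iff_eq_add']
    exact TwoPhase.eq_polarBound_iff_isPeriodicEInclusion hκ.ne' hθ₀ hθ₁ hF hFs hd rfl hΩo hΩY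
      hvol hT hrange fun G₀ hG₀ => (key G₀ hG₀).2
  · intro hle
    have hd := (TwoPhase.boundDenom_neg_of_le hL₀_eq hL₁ ⟨0, hn⟩ hθ₀ hT h1r hle).ne
    refine ⟨hd, fun Ω Le F hΩY hΩ hvol hLe hFs => ?_⟩
    have hθ := (TwoPhase.integral_phaseChar hΩ hΩY).trans hvol
    obtain ⟨u, g, H, -, hpol⟩ := TwoPhase.exists_isW22Per_isPolarField b hΩ hθ
    have hneg : ∀ F, 0 ≤ TwoPhase.frob F ((-(L₁ - L₀)) F) := fun F => by
      rw [neg_sub]; exact hle F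
    have key := fun G₀ hG₀ => TwoPhase.upper_bound (G₀ := G₀) (F := F)
      (t := (μ₁ + μ₂ + lam) * F.trace / TwoPhase.boundDenom L₁ L₀ (μ₁ + μ₂ + lam) θ)
      hL₀_eq hL₀ hL₁ ⟨0, hn⟩ hD hX hneg hΩ hθ hLe hG₀
    rw [hval F hd] at key
    refine ⟨by linarith [(key _ (hpol _)).1], fun hF hΩo => ?_⟩
    rw [sub_eq_iff_eq_add']
    exact TwoPhase.eq_polarBound_iff_isPeriodicEInclusion hκ.ne' hθ₀ hθ₁ hF hFs hd rfl hΩo hΩY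
      hvol hT hrange fun G₀ hG₀ => (key G₀ hG₀).2
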